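/- **Definitions.** Let $X$ be a finite poset with minimum $\hat 0$ and maximum $\hat 1$, graded with rank function $\rho$ (so $\rho(\hat 0)=0$ and $\rho(y)=\rho(x)+1$ whenever $y$ covers $x$). For $f,g:X\to\mathbb{Z}$ write $f\sim g$ if $\sum_{x\in X}q^{f(x)}=\sum_{x\in X}q^{g(x)}$ in $\mathbb{N}[q,q^{-1}]$, $f(\hat 0)=g(\hat 0)$ and $f(\hat 1)=g(\hat 1)$; let $[f]$ be the class of $f$. A bijection $X\simeq A\times B$ is a *good decomposition* if, for the orders on $A$ and $B$ induced from $X$ by the inclusions $a\mapsto(a,b)$ and $b\mapsto(a,b)$ (for any fixed $b$, respectively $a$), $A$ and $B$ are graded posets with minimum, maximum and rank functions $\rho_A,\rho_B$, and $\rho=\rho_A\circ\pi_A+\rho_B\circ\pi_B$. Given a good decomposition, $f\in[\rho]$ is *induced* by $g:B\to\mathbb{Z}$ if $g\in[\rho_B]$ and $f-\rho_A\circ\pi_A=g\circ\pi_B$. Let $S_n^B$ be the group of bijections $\sigma$ of $\{\pm1,\dots,\pm n\}$ with $\sigma(-a)=-\sigma(a)$, with generators $S=\{s_0,s_1,\dots,s_{n-1}\}$,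 where $s_0=(-1,2,\dots,n)$ and $s_i=(1,\dots,i-1,i+1,i,i+2,\dots,n)$ as sequences $(\sigma(1),\dots,\sigma(n))$. Let $\ell_B$ be the length with respect to $S$, and order $W=S_n^B$ by the Bruhat order. Let $J=\{s_1,\dots,s_{n-1}\}$, let $W_J$ be the subgroup generated by $J$ (identified with $S_n$ through the sequences $(\sigma(1),\dots,\sigma(n))$), and let $W^J=\{w\in W:\ell_B(ws)>\ell_B(w)\ \forall s\in J\}$. The major index $\mathrm{maj}(a_1,\dots,a_n)$ of a sequence of integers is the sum of the $i\in\{1,\dots,n-1\}$ with $a_i>a_{i+1}$, and the negative major index of $\sigma\in S_n^B$ is $$\mathrm{nmaj}(\sigma)=\mathrm{maj}(\sigma(1),\dots,\sigma(n))-\sum_{i\in[n],\ \sigma(i)<0}\sigma(i).$$ **Proposition.** Let $n\ge 2$. Every $w\in S_n^B$ factors uniquely as $w=w^Jw_J$ with $w^J\in W^J$ and $w_J\in W_J$, the bijection $w\mapsto(w^J,w_J)$ is a good decomposition $S_n^B\simeq W^J\times W_J$ of the Bruhat order (all rank functions being given by $\ell_B$), and with respect to it $\mathrm{nmaj}$ is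 induced by the function $\mathrm{maj}$ on $W_J\cong S_n$. In particular $\mathrm{nmaj}\in[\ell_B]$, $\mathrm{maj}\in[\ell_B|_{W_J}]$, and $$\mathrm{nmaj}(w)=\ell_B(w^J)+\mathrm{maj}(w_J)\qquad\text{for all } w\in S_n^B.$$ -/

import Mathlib

/-! ### Graded posets, equidistributed functions and induced functions -/

/-- `X` (a finite poset) has a minimum and a maximum and is graded with rank function `ρ`. -/
structure IsGradedPoset {X : Type*} [PartialOrder X] [Finite X] (ρ : X → ℕ) : Prop where
  exists_min : ∃ x : X, IsBot x
  exists_max : ∃ x : X, IsTop x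
  rank_min : ∀ x : X, IsBot x → ρ x = 0
  rank_covBy : ∀ x y : X, x ⋖ y → ρ y = ρ x + 1

/-- `∑ q ^ f x = ∑ q ^ g x` as Laurent polynomials in `q` with coefficients in `ℕ`. -/
def Equidistributed {X : Type*} [Finite X] (f g : X → ℤ) : Prop :=
  ∑ᶠ x : X, (LaurentPolynomial.T (f x) : LaurentPolynomial ℕ) =
    ∑ᶠ x : X, (LaurentPolynomial.T (g x) : LaurentPolynomial ℕ)

/-- The equivalence relation `f ∼ g`: equidistributed, with the same value at the minimum and the
same value at the maximum. Thus `f ∈ [ρ]` is `EquivDistributed f (fun x => (ρ x : ℤ))`. -/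
structure EquivDistributed {X : Type*} [PartialOrder X] [Finite X] (f g : X → ℤ) : Prop where
  equidistributed : Equidistributed f g
  eq_at_min : ∀ x : X, IsBot x → f x = g x
  eq_at_max : ∀ x : X, IsTop x → f x = g x

/-- The bijection `e : X ≃ A × B` is a good decomposition of the graded poset `(X, ρ)`: the orders
on `A` and `B` are those induced by the inclusions `a ↦ (a, b)` and `b ↦ (a, b)` into `X`,
they are graded with rank functions `ρA` and `ρB`, and `ρ = ρA ∘ π_A + ρB ∘ π_B`. -/
structure IsGoodDecomposition {X A B : Type*} [PartialOrder X] [PartialOrder A] [PartialOrder B]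
    [Finite X] [Finite A] [Finite B] (e : X ≃ A × B) (ρ : X → ℕ) (ρA : A → ℕ) (ρB : B → ℕ) :
    Prop where
  le_iff_left : ∀ (b : B) (a a' : A), e.symm (a, b) ≤ e.symm (a', b) ↔ a ≤ a'
  le_iff_right : ∀ (a : A) (b b' : B), e.symm (a, b) ≤ e.symm (a, b') ↔ b ≤ b'
  graded : IsGradedPoset ρ
  graded_left : IsGradedPoset ρA
  graded_right : IsGradedPoset ρB
  rank_eq : ∀ x : X, ρ x = ρA (e x).1 + ρB (e x).2

/-- With respect to the good decomposition `e : X ≃ A × B`, the function `f ∈ [ρ]` is induced by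
the function `g ∈ [ρB]`: one has `R(f) = g ∘ π_B`, where `R(f) = f - ρA ∘ π_A`. -/
structure IsInducedBy {X A B : Type*} [PartialOrder X] [PartialOrder A] [PartialOrder B]
    [Finite X] [Finite A] [Finite B] (e : X ≃ A × B) (ρ : X → ℕ) (ρA : A → ℕ) (ρB : B → ℕ)
    (f : X → ℤ) (g : B → ℤ) : Prop where
  good : IsGoodDecomposition e ρ ρA ρB
  mem_class : EquivDistributed f (fun x => (ρ x : ℤ))
  mem_class_right : EquivDistributed g (fun b => (ρB b : ℤ))
  eq_comp : ∀ x : X, f x - (ρA (e x).1 : ℤ) = g (e x).2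

/-! ### Length, Bruhat order and parabolic quotients -/

/-- The length of `w` with respect to the generating set `S`. -/
noncomputable def wordLength {G : Type*} [Group G] (S : Set G) (w : G) : ℕ :=
  sInf {k : ℕ | ∃ l : List G, l.length = k ∧ (∀ s ∈ l, s ∈ S) ∧ l.prod = w}

/-- The set `T` of reflections, i.e. of conjugates of elements of `S`. -/
def reflections {G : Type*} [Group G] (S : Set G) : Set G :=
  {t : G | ∃ w : G, ∃ s ∈ S, t = w * s * w⁻¹}

/-- One step `u → u t` of the Bruhat order: `t` is a reflection and the length increases. -/
def BruhatStep {G : Type*} [Group G] (S : Set G) (u v : G) : Prop :=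
  ∃ t ∈ reflections S, v = u * t ∧ wordLength S u < wordLength S v

/-- The Bruhat order. -/
def BruhatLE {G : Type*} [Group G] (S : Set G) : G → G → Prop :=
  Relation.ReflTransGen (BruhatStep S)

theorem BruhatLE.eq_or_length_lt {G : Type*} [Group G] {S : Set G} {u v : G}
    (h : BruhatLE S u v) : u = v ∨ wordLength S u < wordLength S v := by
  induction h with
  | refl => exact Or.inl rfl
  | tail _ hs ih =>
    obtain ⟨t, _, _, hlt⟩ := hs
    rcases ih with rfl | ih
    · exact Or.inr hlt
    · exact Or.inr (ih.trans hlt)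

/-- `W^J`, the set of `w` with `ℓ(w s) > ℓ(w)` for all `s ∈ J`. -/
def parabolicQuotient {G : Type*} [Group G] (S J : Set G) : Set G :=
  {w : G | ∀ s ∈ J, wordLength S w < wordLength S (w * s)}

/-! ### The hyperoctahedral group -/

/-- The set `[±n] = {-n, …, -1, 1, …, n}`. -/
abbrev PlusMinus (n : ℕ) : Type := {z : ℤ // z ≠ 0 ∧ |z| ≤ (n : ℤ)}

instance PlusMinus.instInvolutiveNeg (n : ℕ) : InvolutiveNeg (PlusMinus n) where
  neg z := ⟨-z.1, neg_ne_zero.mpr z.2.1, by rw [abs_neg]; exact z.2.2⟩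
  neg_neg z := Subtype.ext (neg_neg z.1)

instance PlusMinus.instFinite (n : ℕ) : Finite (PlusMinus n) :=
  Set.Finite.to_subtype ((Set.finite_Icc (-(n : ℤ)) n).subset fun _ hz => abs_le.mp hz.2)

/-- The element `i + 1` of `[±n]`, for `i` in `{0, …, n - 1}`. -/
def PlusMinus.pos {n : ℕ} (i : Fin n) : PlusMinus n :=
  ⟨(i : ℤ) + 1, by omega, by rw [abs_of_nonneg (by omega)]; omega⟩

/-- The hyperoctahedral group `S_n^B`: the permutations `w` of `[±n]` with `w (-a) = -w a`. -/
def SignedPerm (n : ℕ) : Subgroup (Equiv.Perm (PlusMinus n)) where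
  carrier := {w | ∀ a, w (-a) = -w a}
  one_mem' := fun _ => rfl
  mul_mem' := by
    intro u v hu hv a
    rw [Equiv.Perm.mul_apply, Equiv.Perm.mul_apply, hv, hu]
  inv_mem' := by
    intro u hu a
    rw [Equiv.Perm.inv_eq_iff_eq, hu, ← Equiv.Perm.mul_apply, mul_inv_cancel, Equiv.Perm.one_apply]

namespace SignedPerm

/-- The sequence `(w(1), …, w(n))`; its entry number `i + 1` is indexed by `i : Fin n`. -/
def window {n : ℕ} (w : SignedPerm n) (i : Fin n) : ℤ :=
  ((w : Equiv.Perm (PlusMinus n)) (PlusMinus.pos i) : PlusMinus n).1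

/-- The involution `a ↦ -a` exchanging `c` and `-c` and fixing all other elements. -/
def signChange {n : ℕ} (c : PlusMinus n) : SignedPerm n :=
  ⟨Equiv.swap c (-c), by
    intro a
    have hn : ∀ x : PlusMinus n, - -x = x := neg_neg
    simp only [Equiv.swap_apply_def]
    grind⟩

/-- The signed permutation exchanging `c` with `d` and `-c` with `-d`, where `d ≠ ±c`. -/
def exchange {n : ℕ} (c d : PlusMinus n) (h : c ≠ d) (h' : c ≠ -d) : SignedPerm n :=
  ⟨Equiv.swap c d * Equiv.swap (-c) (-d), by
    intro a
    have hc : c ≠ -c := fun h0 => c.2.1 (by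
      have h1 : c.1 = -c.1 := congrArg Subtype.val h0
      omega)
    have hd : d ≠ -d := fun h0 => d.2.1 (by
      have h1 : d.1 = -d.1 := congrArg Subtype.val h0
      omega)
    have hn : ∀ x : PlusMinus n, - -x = x := neg_neg
    simp only [Equiv.Perm.mul_apply, Equiv.swap_apply_def]
    grind⟩

/-- The generators `s_0, s_1, …, s_{n-1}`: `s_0` exchanges `1` and `-1`, and `s_i` exchanges `i` with
`i + 1` and `-i` with `-(i + 1)` for `1 ≤ i ≤ n - 1`. -/
def simple {n : ℕ} (i : Fin n) : SignedPerm n :=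
  if h : (i : ℕ) = 0 then signChange (PlusMinus.pos i)
  else exchange (PlusMinus.pos ⟨(i : ℕ) - 1, by omega⟩) (PlusMinus.pos i)
    (fun h0 => by
      have h1 : (((i : ℕ) - 1 : ℕ) : ℤ) + 1 = (i : ℤ) + 1 := congrArg Subtype.val h0
      omega)
    (fun h0 => by
      have h1 : (((i : ℕ) - 1 : ℕ) : ℤ) + 1 = -((i : ℤ) + 1) := congrArg Subtype.val h0
      omega)

/-- `S = {s_0, s_1, …, s_{n-1}}`. -/
def generators (n : ℕ) : Set (SignedPerm n) := Set.range simple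

/-- `J = {s_1, …, s_{n-1}}`. -/
def unsignedGenerators (n : ℕ) : Set (SignedPerm n) := {w | ∃ i : Fin n, (i : ℕ) ≠ 0 ∧ w = simple i}

/-- The length `ℓ_B` with respect to `S`. -/
noncomputable def length {n : ℕ} (w : SignedPerm n) : ℕ := wordLength (generators n) w

/-- The Bruhat order of `S_n^B` with respect to `S`. -/
instance instPartialOrder (n : ℕ) : PartialOrder (SignedPerm n) where
  le := BruhatLE (generators n)
  le_refl _ := Relation.ReflTransGen.refl
  le_trans _ _ _ := Relation.ReflTransGen.trans
  le_antisymm u v huv hvu := by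
    rcases BruhatLE.eq_or_length_lt huv with h | h
    · exact h
    · rcases BruhatLE.eq_or_length_lt hvu with h' | h'
      · exact h'.symm
      · exact absurd h (lt_asymm h')

/-- The quotient `W^J`; as a subtype it carries the induced Bruhat order. -/
def quotientJ (n : ℕ) : Set (SignedPerm n) :=
  parabolicQuotient (generators n) (unsignedGenerators n)

/-- The parabolic subgroup `W_J`, generated by `J`; as a subtype it carries the induced
Bruhat order. -/
def parabolicJ (n : ℕ) : Subgroup (SignedPerm n) := Subgroup.closure (unsignedGenerators n)

end SignedPerm

/-! ### Major index and negative major index -/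

/-- The major index `∑ i` over the descents `i` (`a_i > a_{i+1}`) of `(a_1, …, a_n)`; the entry
`a_{i+1}` is `a i` for `i : Fin n`, so that `i` encodes the position `i + 1`. -/
def majorIndex {n : ℕ} (a : Fin n → ℤ) : ℤ :=
  ∑ i : Fin n, if ∃ h : (i : ℕ) + 1 < n, a ⟨(i : ℕ) + 1, h⟩ < a i then (i : ℤ) + 1 else 0

/-- The major index on `S_n`, where `τ` is read as the sequence `(τ(1), …, τ(n))`. -/
def permMajorIndex {n : ℕ} (τ : Equiv.Perm (Fin n)) : ℤ :=
  majorIndex fun i => ((τ i : ℕ) : ℤ) + 1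

/-- `nmaj(σ) = maj(σ) - ∑ σ(i)`, summed over the `i` with `σ(i) < 0`. -/
def negMajorIndex {n : ℕ} (σ : SignedPerm n) : ℤ :=
  majorIndex (SignedPerm.window σ) -
    ∑ i : Fin n, if SignedPerm.window σ i < 0 then SignedPerm.window σ i else 0

/-! The order-theoretic half holds for any group with a generating set `S` of involutions and an
inversion predicate satisfying the cocycle rule of `IsInversionCocycle`. The rule gives strong
exchange (`exists_sublist_of_inv`), hence `ℓ(wt) < ℓ(w)` exactly when the reflection `t` is an
inversion of `w`, and then the lifting property for left and right multiplication by generators.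
Lifting yields length additivity on `W^J × W_J`, the fact that translating by an element of `W_J` or
of `W^J` preserves and reflects the order on the other factor, and gradedness of `W`, `W^J` and
`W_J`. For signed permutations, `t` is an inversion of `w` when `w` reverses some pair `x < t x`.

The combinatorial half rests on two facts about `a ∈ W^J`. Its window is increasing, so `a * τ` has
the descents of `τ`. Its length is minus the sum of its negative entries
(`length_eq_of_mem_quotientJ`), a sum that right multiplication by `τ` only reorders. Hence
`nmaj(aτ) = ℓ(a) + maj(τ)`.

Equidistribution of `nmaj` with length thus reduces to MacMahon's theorem on `S_n`
(`sum_permMajorIndex`), proved by showing that both generating functions obey one recursion. At the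
maximum of `W_J` both `maj` and the length are maximal, so being equidistributed they agree there.
Minima and maxima of `W` project to those of `W_J`, which settles `nmaj`. -/

/-! ### Inversion cocycles and the Bruhat order -/

section Coxeter

variable {G : Type*} [Group G] {S J : Set G} {inv : G → G → Prop}

/-- `S` is a generating set of involutions of `G`, and `inv w t` ("the reflection `t` is an
inversion of `w`") is a cocycle normalised on the generators. -/
structure IsInversionCocycle (S : Set G) (inv : G → G → Prop) : Prop where
  mul_self : ∀ s ∈ S, s * s = 1
  closure_eq : Subgroup.closure S = ⊤
  not_inv_one : ∀ t ∈ reflections S, ¬ inv 1 t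
  inv_mul : ∀ (w : G), ∀ s ∈ S, ∀ t ∈ reflections S,
    (inv (w * s) t ↔ (t = s ↔ ¬ inv w (s * t * s)))

/-! ### Words in generators and elementary facts on length. -/

theorem mem_reflections_of_mem {s : G} (hs : s ∈ S) : s ∈ reflections S :=
  ⟨1, s, hs, by simp⟩

theorem conj_mem_reflections {t : G} (ht : t ∈ reflections S) (x : G) :
    x * t * x⁻¹ ∈ reflections S := by
  obtain ⟨w, s, hs, rfl⟩ := ht
  exact ⟨x * w, s, hs, by group⟩

theorem exists_list_of_mem_closure_of_mul_self (hJ : ∀ s ∈ J, s * s = 1) {w : G}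
    (hw : w ∈ Subgroup.closure J) : ∃ l : List G, (∀ s ∈ l, s ∈ J) ∧ l.prod = w := by
  induction hw using Subgroup.closure_induction with
  | mem s hs => exact ⟨[s], by simpa using hs, by simp⟩
  | one => exact ⟨[], by simp, rfl⟩
  | mul x y _ _ hx hy =>
    obtain ⟨l, hl, rfl⟩ := hx
    obtain ⟨m, hm, rfl⟩ := hy
    exact ⟨l ++ m, fun s hs => (List.mem_append.mp hs).elim (hl s) (hm s), List.prod_append⟩
  | inv x _ hx =>
    obtain ⟨l, hl, rfl⟩ := hx
    refine ⟨(l.map fun x => x⁻¹).reverse, fun s hs => ?_, (List.prod_inv_reverse l).symm⟩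
    simp only [List.mem_reverse, List.mem_map] at hs
    obtain ⟨a, ha, rfl⟩ := hs
    rw [inv_eq_of_mul_eq_one_left (hJ a (hl a ha))]
    exact hl a ha

theorem list_prod_mem_closure {l : List G} (hl : ∀ s ∈ l, s ∈ J) :
    l.prod ∈ Subgroup.closure J :=
  Subgroup.list_prod_mem _ fun s hs => Subgroup.subset_closure (hl s hs)

theorem wordLength_le {l : List G} (hl : ∀ s ∈ l, s ∈ S) : wordLength S l.prod ≤ l.length :=
  Nat.sInf_le ⟨l, rfl, hl, rfl⟩

theorem wordLength_one : wordLength S (1 : G) = 0 :=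
  Nat.le_zero.mp (wordLength_le (S := S) (l := []) (by simp))

theorem BruhatLE.le_mul {w s : G} (hs : s ∈ S) (hlt : wordLength S w < wordLength S (w * s)) :
    BruhatLE S w (w * s) :=
  Relation.ReflTransGen.single ⟨s, mem_reflections_of_mem hs, rfl, hlt⟩

theorem BruhatLE.length_le {u v : G} (huv : BruhatLE S u v) : wordLength S u ≤ wordLength S v := by
  rcases huv.eq_or_length_lt with rfl | h1
  · exact le_rfl
  · exact h1.le

/-! ### Strong exchange, and inversions as length-decreasing reflections. -/

namespace IsInversionCocycle

variable (h : IsInversionCocycle S inv)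
include h

theorem inv_eq {s : G} (hs : s ∈ S) : s⁻¹ = s :=
  inv_eq_of_mul_eq_one_left (h.mul_self s hs)

theorem mul_mul_self {s : G} (hs : s ∈ S) (w : G) : w * s * s = w := by
  rw [mul_assoc, h.mul_self s hs, mul_one]

theorem self_mul_mul {s : G} (hs : s ∈ S) (w : G) : s * (s * w) = w := by
  rw [← mul_assoc, h.mul_self s hs, one_mul]

theorem reflection_mul_self {t : G} (ht : t ∈ reflections S) : t * t = 1 := by
  obtain ⟨w, s, hs, rfl⟩ := ht
  have := h.mul_self s hs
  calc w * s * w⁻¹ * (w * s * w⁻¹) = w * (s * s) * w⁻¹ := by group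
    _ = 1 := by rw [this]; group

theorem exists_list (w : G) : ∃ l : List G, (∀ s ∈ l, s ∈ S) ∧ l.prod = w :=
  exists_list_of_mem_closure_of_mul_self h.mul_self (by rw [h.closure_eq]; trivial)

theorem exists_reduced (w : G) :
    ∃ l : List G, l.length = wordLength S w ∧ (∀ s ∈ l, s ∈ S) ∧ l.prod = w := by
  obtain ⟨l, hl, hw⟩ := h.exists_list w
  exact Nat.sInf_mem (s := {k : ℕ | ∃ l : List G, l.length = k ∧ (∀ s ∈ l, s ∈ S) ∧ l.prod = w})
    ⟨_, l, rfl, hl, hw⟩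

theorem length_eq_zero {w : G} : wordLength S w = 0 ↔ w = 1 := by
  constructor
  · intro h0
    obtain ⟨l, hl, -, rfl⟩ := h.exists_reduced w
    rw [h0, List.length_eq_zero_iff] at hl
    simp [hl]
  · rintro rfl
    exact wordLength_one

theorem length_mul_le (w : G) {s : G} (hs : s ∈ S) :
    wordLength S (w * s) ≤ wordLength S w + 1 := by
  obtain ⟨l, hl, hS, rfl⟩ := h.exists_reduced w
  have := wordLength_le (S := S) (l := l ++ [s]) (by simpa [or_imp, forall_and] using ⟨hS, hs⟩)
  simpa [hl] using this

theorem length_inv_le (w : G) : wordLength S w⁻¹ ≤ wordLength S w := by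
  obtain ⟨l, hl, hS, rfl⟩ := h.exists_reduced w
  rw [List.prod_inv_reverse, ← hl]
  refine (wordLength_le (S := S) (l := (l.map fun x => x⁻¹).reverse) ?_).trans (by simp)
  intro s hs
  simp only [List.mem_reverse, List.mem_map] at hs
  obtain ⟨a, ha, rfl⟩ := hs
  rw [h.inv_eq (hS a ha)]
  exact hS a ha

theorem length_inv (w : G) : wordLength S w⁻¹ = wordLength S w :=
  le_antisymm (h.length_inv_le w) (by simpa using h.length_inv_le w⁻¹)

theorem length_mul_left_le (w : G) {s : G} (hs : s ∈ S) :
    wordLength S (s * w) ≤ wordLength S w + 1 := by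
  have := h.length_mul_le w⁻¹ hs
  rwa [← h.length_inv (w⁻¹ * s), mul_inv_rev, inv_inv, h.inv_eq hs, h.length_inv w] at this

theorem conj_mem {s t : G} (hs : s ∈ S) (ht : t ∈ reflections S) : s * t * s ∈ reflections S := by
  simpa [h.inv_eq hs] using conj_mem_reflections ht s

/-- Strong exchange: an inversion of a product of generators is removed by deleting letters. -/
theorem exists_sublist_of_inv (l : List G) (hl : ∀ s ∈ l, s ∈ S) (t : G)
    (ht : t ∈ reflections S) (hi : inv l.prod t) :
    ∃ l' : List G, l'.Sublist l ∧ l'.length < l.length ∧ l'.prod = l.prod * t := by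
  induction l using List.reverseRecOn generalizing t with
  | nil => exact absurd hi (h.not_inv_one t ht)
  | append_singleton l s ih =>
    have hs : s ∈ S := hl s (by simp)
    have hl' : ∀ r ∈ l, r ∈ S := fun r hr => hl r (by simp [hr])
    rw [List.prod_append, List.prod_singleton, h.inv_mul _ s hs t ht] at hi
    -- For `t = s` the last letter is deleted. Otherwise the cocycle rule makes `s * t * s` an
    -- inversion of the shorter word, and the letter `s` is put back after the deletion.
    by_cases hts : t = s
    · subst hts
      refine ⟨l, List.sublist_append_left _ _, by simp, ?_⟩
      simp [h.mul_mul_self hs]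
    · have hi' : inv l.prod (s * t * s) := by tauto
      obtain ⟨l', hsub, hlen, hp⟩ := ih hl' _ (h.conj_mem hs ht) hi'
      refine ⟨l' ++ [s], hsub.append (List.Sublist.refl _), by simpa using hlen, ?_⟩
      rw [List.prod_append, List.prod_append, hp, List.prod_singleton]
      simp only [mul_assoc]
      rw [h.mul_self s hs, mul_one]

/-- The cocycle rule settles the case where `t` is a generator. In general `t` is a conjugate of a
generator, and the conjugating word is peeled off letter by letter: passing from `t'` to `r * t' *
r` toggles both sides together or neither. -/
theorem inv_mul_reflection (w : G) {t : G} (ht : t ∈ reflections S) :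
    inv (w * t) t ↔ ¬ inv w t := by
  obtain ⟨x, s, hs, rfl⟩ := ht
  obtain ⟨l, hl, rfl⟩ := h.exists_list x
  induction l generalizing w with
  | nil =>
    have := h.inv_mul w s hs s (mem_reflections_of_mem hs)
    rw [h.mul_self s hs, one_mul] at this
    simpa using this
  | cons r l ih =>
    have hr : r ∈ S := hl r (by simp)
    have hl' : ∀ r ∈ l, r ∈ S := fun r hr => hl r (by simp [hr])
    set t' := l.prod * s * l.prod⁻¹ with ht'
    have ht'm : t' ∈ reflections S := ⟨_, s, hs, rfl⟩
    have e : (r :: l).prod * s * (r :: l).prod⁻¹ = r * t' * r := by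
      rw [List.prod_cons, mul_inv_rev, h.inv_eq hr, ht']; group
    rw [e]
    have e2 : r * (r * t' * r) * r = t' := by
      calc r * (r * t' * r) * r = (r * r) * t' * (r * r) := by group
        _ = t' := by rw [h.mul_self r hr]; group
    have h1 := h.inv_mul (w * r * t') r hr _ (h.conj_mem hr ht'm)
    rw [e2, ih (w * r) hl', h.inv_mul w r hr t' ht'm] at h1
    have e3 : w * (r * t' * r) = w * r * t' * r := by group
    rw [e3, h1]
    have e4 : r * t' * r = r ↔ t' = r := by
      constructor
      · intro h5
        rw [← e2, h5, h.mul_self r hr, one_mul]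
      · rintro h5
        rw [h5, h.mul_self r hr, one_mul]
    tauto

theorem length_lt_of_inv {w t : G} (ht : t ∈ reflections S) (hi : inv w t) :
    wordLength S (w * t) < wordLength S w := by
  obtain ⟨l, hl, hS, rfl⟩ := h.exists_reduced w
  obtain ⟨l', hsub, hlen, hp⟩ := h.exists_sublist_of_inv l hS t ht hi
  rw [← hp, ← hl]
  exact (wordLength_le fun s hs => hS s (hsub.subset hs)).trans_lt hlen

theorem lt_length_of_not_inv {w t : G} (ht : t ∈ reflections S) (hi : ¬ inv w t) :
    wordLength S w < wordLength S (w * t) := by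
  have := h.length_lt_of_inv ht ((h.inv_mul_reflection w ht).mpr hi)
  rwa [mul_assoc, h.reflection_mul_self ht, mul_one] at this

theorem lt_length_iff {w t : G} (ht : t ∈ reflections S) :
    wordLength S w < wordLength S (w * t) ↔ ¬ inv w t :=
  ⟨fun hlt hi => lt_asymm hlt (h.length_lt_of_inv ht hi), h.lt_length_of_not_inv ht⟩

theorem length_mul_of_lt {w s : G} (hs : s ∈ S) (hlt : wordLength S w < wordLength S (w * s)) :
    wordLength S (w * s) = wordLength S w + 1 := by
  have := h.length_mul_le w hs
  omega

theorem length_mul_left_of_lt {w s : G} (hs : s ∈ S)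
    (hlt : wordLength S w < wordLength S (s * w)) :
    wordLength S (s * w) = wordLength S w + 1 := by
  have := h.length_mul_left_le w hs
  omega

theorem length_of_mul_lt {w s : G} (hs : s ∈ S) (hlt : wordLength S (w * s) < wordLength S w) :
    wordLength S w = wordLength S (w * s) + 1 := by
  have := h.length_mul_le (w * s) hs
  rw [h.mul_mul_self hs] at this
  omega

theorem length_of_mul_left_lt {w s : G} (hs : s ∈ S)
    (hlt : wordLength S (s * w) < wordLength S w) :
    wordLength S w = wordLength S (s * w) + 1 := by
  have := h.length_mul_left_le (s * w) hs
  rw [h.self_mul_mul hs] at this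
  omega

theorem lt_or_gt (w : G) {s : G} (hs : s ∈ S) :
    wordLength S w < wordLength S (w * s) ∨ wordLength S (w * s) < wordLength S w := by
  by_cases hi : inv w s
  · exact Or.inr (h.length_lt_of_inv (mem_reflections_of_mem hs) hi)
  · exact Or.inl (h.lt_length_of_not_inv (mem_reflections_of_mem hs) hi)

theorem length_left_eq (w : G) {s : G} (hs : s ∈ S) :
    wordLength S (s * w) = wordLength S (w⁻¹ * s) := by
  rw [← h.length_inv (s * w), mul_inv_rev, h.inv_eq hs]

theorem lt_or_gt_left (w : G) {s : G} (hs : s ∈ S) :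
    wordLength S w < wordLength S (s * w) ∨ wordLength S (s * w) < wordLength S w := by
  rw [h.length_left_eq w hs, ← h.length_inv w]
  exact h.lt_or_gt w⁻¹ hs

/-- The cocycle identity for general products. -/
theorem inv_mul_iff (u c : G) {t : G} (ht : t ∈ reflections S) :
    inv (u * c) t ↔ (inv u (c * t * c⁻¹) ↔ ¬ inv c t) := by
  obtain ⟨l, hl, rfl⟩ := h.exists_list c
  induction l using List.reverseRecOn generalizing t with
  | nil =>
    have := h.not_inv_one t ht
    simp [this]
  | append_singleton l s ih =>
    have hs : s ∈ S := hl s (by simp)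
    have hl' : ∀ r ∈ l, r ∈ S := fun r hr => hl r (by simp [hr])
    have e : (l ++ [s]).prod = l.prod * s := by simp
    have e2 : l.prod * s * t * (l.prod * s)⁻¹ = l.prod * (s * t * s) * l.prod⁻¹ := by
      rw [mul_inv_rev, h.inv_eq hs]; group
    rw [e, ← mul_assoc u, h.inv_mul _ s hs t ht, h.inv_mul _ s hs t ht,
      ih (h.conj_mem hs ht) hl', e2]
    tauto

/-! #### The lifting property -/

/-- For `t ≠ s` the reflection `s * t * s` differs from `s`, so by the cocycle rule it is an
inversion of `u * s` exactly when `t` is one of `u`. Translating by `s` can therefore spoil only the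
step `u → u * s`. -/
theorem step_mul {u v s : G} (hs : s ∈ S) (huv : BruhatStep S u v) :
    v = u * s ∨ BruhatStep S (u * s) (v * s) := by
  obtain ⟨t, ht, rfl, hlt⟩ := huv
  by_cases hts : t = s
  · exact Or.inl (by rw [hts])
  · right
    have e : u * t * s = u * s * (s * t * s) := by
      calc u * t * s = u * (s * s) * t * s := by rw [h.mul_self s hs]; group
        _ = _ := by group
    have e2 : s * (s * t * s) * s = t := by
      calc s * (s * t * s) * s = (s * s) * t * (s * s) := by group
        _ = t := by rw [h.mul_self s hs]; group
    have e4 : s * t * s ≠ s := fun h5 => hts (by rw [← e2, h5, h.mul_self s hs, one_mul])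
    refine ⟨_, h.conj_mem hs ht, e, ?_⟩
    rw [e, h.lt_length_iff (h.conj_mem hs ht), h.inv_mul _ s hs _ (h.conj_mem hs ht), e2]
    rw [h.lt_length_iff ht] at hlt
    tauto

theorem mul_le_of_lt {w s : G} (hs : s ∈ S) (hlt : wordLength S (w * s) < wordLength S w) :
    BruhatLE S (w * s) w :=
  Relation.ReflTransGen.single ⟨s, mem_reflections_of_mem hs, (h.mul_mul_self hs w).symm, hlt⟩

/-- A chain translated by `s` stays a chain until some link is itself multiplication by `s`; there
the translated chain meets the original one. The lifting lemmas below all follow from this and from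
`le_mul_or`. -/
theorem mul_le_or {u v s : G} (hs : s ∈ S) (huv : BruhatLE S u v) :
    BruhatLE S (u * s) v ∨ BruhatLE S (u * s) (v * s) := by
  induction huv with
  | refl => exact Or.inr Relation.ReflTransGen.refl
  | tail _ hst ih =>
    rcases ih with ih | ih
    · exact Or.inl (ih.tail hst)
    · rcases h.step_mul hs hst with rfl | h1
      · exact Or.inl ih
      · exact Or.inr (ih.tail h1)

theorem le_mul_or {u v s : G} (hs : s ∈ S) (huv : BruhatLE S u v) :
    BruhatLE S u (v * s) ∨ BruhatLE S (u * s) (v * s) := by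
  induction huv with
  | refl => exact Or.inr Relation.ReflTransGen.refl
  | tail h0 hst ih =>
    rcases h.step_mul hs hst with rfl | h1
    · rw [h.mul_mul_self hs]
      exact Or.inl h0
    · rcases ih with ih | ih
      · exact Or.inl (ih.tail h1)
      · exact Or.inr (ih.tail h1)

theorem lift_up {u v s : G} (hs : s ∈ S) (huv : BruhatLE S u v)
    (hv : wordLength S v < wordLength S (v * s)) : BruhatLE S (u * s) (v * s) :=
  (h.mul_le_or hs huv).elim (fun h1 => h1.trans (BruhatLE.le_mul hs hv)) id

theorem lift_top {u v s : G} (hs : s ∈ S) (huv : BruhatLE S u v)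
    (hv : wordLength S (v * s) < wordLength S v) : BruhatLE S (u * s) v :=
  (h.mul_le_or hs huv).elim id fun h1 => h1.trans (h.mul_le_of_lt hs hv)

theorem lift_down {u v s : G} (hs : s ∈ S) (huv : BruhatLE S u v)
    (hu : wordLength S u < wordLength S (u * s)) : BruhatLE S u (v * s) :=
  (h.le_mul_or hs huv).elim id fun h1 => (BruhatLE.le_mul hs hu).trans h1

theorem lift_both {u v s : G} (hs : s ∈ S) (huv : BruhatLE S u v)
    (hu : wordLength S (u * s) < wordLength S u) : BruhatLE S (u * s) (v * s) :=
  (h.le_mul_or hs huv).elim (fun h1 => (h.mul_le_of_lt hs hu).trans h1) id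

theorem le_inv {u v : G} (huv : BruhatLE S u v) : BruhatLE S u⁻¹ v⁻¹ := by
  refine Relation.ReflTransGen.lift (fun x : G => x⁻¹) (fun a b hab => ?_) u v huv
  obtain ⟨t, ht, rfl, hlt⟩ := hab
  refine ⟨a * t * a⁻¹, conj_mem_reflections ht a, ?_, ?_⟩
  · change (a * t)⁻¹ = a⁻¹ * (a * t * a⁻¹)
    rw [mul_inv_rev, inv_eq_of_mul_eq_one_left (h.reflection_mul_self ht)]; group
  · change wordLength S a⁻¹ < wordLength S (a * t)⁻¹
    rwa [h.length_inv, h.length_inv]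

theorem of_inv_le {u v : G} (huv : BruhatLE S u⁻¹ v⁻¹) : BruhatLE S u v := by
  simpa using h.le_inv huv

theorem inv_mul_left {s : G} (hs : s ∈ S) (w : G) : (s * w)⁻¹ = w⁻¹ * s := by
  rw [mul_inv_rev, h.inv_eq hs]

theorem lift_up_left {u v s : G} (hs : s ∈ S) (huv : BruhatLE S u v)
    (hv : wordLength S v < wordLength S (s * v)) : BruhatLE S (s * u) (s * v) := by
  apply h.of_inv_le
  rw [h.inv_mul_left hs, h.inv_mul_left hs]
  exact h.lift_up hs (h.le_inv huv) (by rwa [← h.length_left_eq v hs, h.length_inv])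

theorem lift_top_left {u v s : G} (hs : s ∈ S) (huv : BruhatLE S u v)
    (hv : wordLength S (s * v) < wordLength S v) : BruhatLE S (s * u) v := by
  apply h.of_inv_le
  rw [h.inv_mul_left hs]
  exact h.lift_top hs (h.le_inv huv) (by rwa [← h.length_left_eq v hs, h.length_inv])

theorem lift_down_left {u v s : G} (hs : s ∈ S) (huv : BruhatLE S u v)
    (hu : wordLength S u < wordLength S (s * u)) : BruhatLE S u (s * v) := by
  apply h.of_inv_le
  rw [h.inv_mul_left hs]
  exact h.lift_down hs (h.le_inv huv) (by rwa [← h.length_left_eq u hs, h.length_inv])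

theorem lift_both_left {u v s : G} (hs : s ∈ S) (huv : BruhatLE S u v)
    (hu : wordLength S (s * u) < wordLength S u) : BruhatLE S (s * u) (s * v) := by
  apply h.of_inv_le
  rw [h.inv_mul_left hs, h.inv_mul_left hs]
  exact h.lift_both hs (h.le_inv huv) (by rwa [← h.length_left_eq u hs, h.length_inv])

theorem mul_le_mul_iff {u v s : G} (hs : s ∈ S) (hu : wordLength S u < wordLength S (u * s))
    (hv : wordLength S v < wordLength S (v * s)) :
    BruhatLE S (u * s) (v * s) ↔ BruhatLE S u v := by
  refine ⟨fun huv => ?_, fun huv => h.lift_up hs huv hv⟩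
  have := h.lift_both hs huv (by rwa [h.mul_mul_self hs])
  rwa [h.mul_mul_self hs, h.mul_mul_self hs] at this

theorem mul_le_mul_left_iff {u v s : G} (hs : s ∈ S)
    (hu : wordLength S u < wordLength S (s * u)) (hv : wordLength S v < wordLength S (s * v)) :
    BruhatLE S (s * u) (s * v) ↔ BruhatLE S u v := by
  refine ⟨fun huv => ?_, fun huv => h.lift_up_left hs huv hv⟩
  have := h.lift_both_left hs huv (by rwa [h.self_mul_mul hs])
  rwa [h.self_mul_mul hs, h.self_mul_mul hs] at this

theorem exists_left_descent {w : G} (hw : w ≠ 1) :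
    ∃ s ∈ S, wordLength S (s * w) < wordLength S w := by
  obtain ⟨l, hl, hS, hp⟩ := h.exists_reduced w
  cases l with
  | nil => exact absurd (by simpa using hp.symm) hw
  | cons s l =>
    have hs : s ∈ S := hS s (by simp)
    refine ⟨s, hs, ?_⟩
    rw [← hl, ← hp, List.prod_cons, h.self_mul_mul hs]
    exact (wordLength_le fun r hr => hS r (by simp [hr])).trans_lt (by simp)

theorem one_le (w : G) : BruhatLE S 1 w := by
  induction hk : wordLength S w using Nat.strong_induction_on generalizing w with
  | _ k ih =>
    subst hk
    by_cases hw : w = 1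
    · subst hw; exact Relation.ReflTransGen.refl
    · obtain ⟨s, hs, hlt⟩ := h.exists_left_descent hw
      have h1 := ih _ hlt (s * w) rfl
      have := h.lift_up_left hs Relation.ReflTransGen.refl (v := s * w)
        (by rwa [h.self_mul_mul hs])
      refine h1.trans ?_
      have h2 := h.lift_top_left hs (Relation.ReflTransGen.refl (a := w)) hlt
      exact h2

/-! #### Parabolic subgroups and quotients -/

/-- Keeping to subwords shows that elements of `W_J` have reduced words with all letters in `J`. -/
theorem exists_reduced_sublist (l : List G) (hl : ∀ s ∈ l, s ∈ S) :
    ∃ l' : List G, l'.Sublist l ∧ l'.prod = l.prod ∧ l'.length = wordLength S l.prod := by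
  induction l using List.reverseRecOn with
  | nil => exact ⟨[], List.Sublist.refl _, rfl, by simp [wordLength_one]⟩
  | append_singleton l s ih =>
    have hs : s ∈ S := hl s (by simp)
    obtain ⟨l', hsub, hp, hlen⟩ := ih fun r hr => hl r (by simp [hr])
    have e : (l ++ [s]).prod = l.prod * s := by simp
    have hl' : ∀ r ∈ l', r ∈ S := fun r hr => hl r (by simp [hsub.subset hr])
    rw [e]
    by_cases hi : inv l.prod s
    · obtain ⟨l'', hsub', hlen', hp'⟩ :=
        h.exists_sublist_of_inv l' hl' s (mem_reflections_of_mem hs) (by rwa [hp])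
      refine ⟨l'', (hsub'.trans hsub).trans (List.sublist_append_left _ _), by rw [hp', hp], ?_⟩
      have h1 := h.length_of_mul_lt hs (h.length_lt_of_inv (mem_reflections_of_mem hs) hi)
      have h2 := wordLength_le (S := S) fun r hr => hl' r (hsub'.subset hr)
      rw [hp', hp] at h2
      omega
    · refine ⟨l' ++ [s], hsub.append (List.Sublist.refl _), by simp [hp], ?_⟩
      have h1 := h.length_mul_of_lt hs (h.lt_length_of_not_inv (mem_reflections_of_mem hs) hi)
      simp [h1, hlen]

theorem exists_reduced_of_mem_closure (hJ : J ⊆ S) {b : G} (hb : b ∈ Subgroup.closure J) :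
    ∃ l : List G, (∀ s ∈ l, s ∈ J) ∧ l.prod = b ∧ l.length = wordLength S b := by
  obtain ⟨l, hl, rfl⟩ :=
    exists_list_of_mem_closure_of_mul_self (fun s hs => h.mul_self s (hJ hs)) hb
  obtain ⟨l', hsub, hp, hlen⟩ := h.exists_reduced_sublist l fun s hs => hJ (hl s hs)
  exact ⟨l', fun s hs => hl s (hsub.subset hs), hp, hlen⟩

/-- Induction over a parabolic subgroup along length-increasing right multiplications. -/
theorem closure_induction_right (hJ : J ⊆ S) {p : G → Prop} (one : p 1)
    (mul : ∀ c ∈ Subgroup.closure J, ∀ r ∈ J, wordLength S c < wordLength S (c * r) → p c →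
      p (c * r)) {b : G} (hb : b ∈ Subgroup.closure J) : p b := by
  obtain ⟨l, hl, rfl, hlen⟩ := h.exists_reduced_of_mem_closure hJ hb
  clear hb
  induction l using List.reverseRecOn with
  | nil => exact one
  | append_singleton l r ih =>
    have hr : r ∈ J := hl r (by simp)
    have hl' : ∀ s ∈ l, s ∈ J := fun s hs => hl s (by simp [hs])
    have e : (l ++ [r]).prod = l.prod * r := by simp
    rw [e] at hlen ⊢
    have h1 := wordLength_le (S := S) fun s hs => hJ (hl' s hs)
    have h2 := h.length_mul_le l.prod (hJ hr)
    simp only [List.length_append, List.length_singleton] at hlen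
    exact mul _ (list_prod_mem_closure hl') r hr (by omega) (ih hl' (by omega))

/-- `W_J` is a lower set: going down one step deletes letters from a word in `J`. This is why
intermediate elements found in `W` stay in `W_J`. -/
theorem mem_closure_of_le (hJ : J ⊆ S) {u v : G} (huv : BruhatLE S u v)
    (hv : v ∈ Subgroup.closure J) : u ∈ Subgroup.closure J := by
  induction huv using Relation.ReflTransGen.head_induction_on with
  | refl => exact hv
  | head hst _ ih =>
    obtain ⟨t, ht, rfl, hlt⟩ := hst
    obtain ⟨l, hl, hp⟩ :=
      exists_list_of_mem_closure_of_mul_self (fun s hs => h.mul_self s (hJ hs)) ih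
    have hi : inv l.prod t := by
      rw [hp, h.inv_mul_reflection _ ht]
      exact (h.lt_length_iff ht).mp hlt
    obtain ⟨l', hsub, -, hp'⟩ := h.exists_sublist_of_inv l (fun s hs => hJ (hl s hs)) t ht hi
    rw [hp, mul_assoc, h.reflection_mul_self ht, mul_one] at hp'
    rw [← hp']
    exact list_prod_mem_closure fun s hs => hl s (hsub.subset hs)

/-- The element `b` is built up by ascents `c → c * r`. If `r` were an inversion of `a * c`, then,
not being one of `c`, it would make `c * r * c⁻¹ ∈ W_J` an inversion of `a`, against minimality. -/
theorem length_mul_of_minimal (hJ : J ⊆ S) {a : G}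
    (ha : ∀ b ∈ Subgroup.closure J, wordLength S a ≤ wordLength S (a * b)) {b : G}
    (hb : b ∈ Subgroup.closure J) :
    wordLength S (a * b) = wordLength S a + wordLength S b := by
  refine h.closure_induction_right hJ (p := fun b =>
    wordLength S (a * b) = wordLength S a + wordLength S b) (by simp [wordLength_one]) ?_ hb
  intro c hc r hr hlt ih
  have hrT := mem_reflections_of_mem (hJ hr)
  have h1 : ¬ inv a (c * r * c⁻¹) := fun hi => by
    have h2 := h.length_lt_of_inv (conj_mem_reflections hrT c) hi
    have h3 := ha (c * r * c⁻¹) (mul_mem (mul_mem hc (Subgroup.subset_closure hr)) (inv_mem hc))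
    omega
  have h2 : ¬ inv (a * c) r := by
    rw [h.inv_mul_iff a c hrT]
    have := (h.lt_length_iff hrT).mp hlt
    tauto
  have h3 := h.length_mul_of_lt (hJ hr) (h.lt_length_of_not_inv hrT h2)
  have h4 := h.length_mul_of_lt (hJ hr) hlt
  rw [← mul_assoc, h3, h4, ih, add_assoc]

theorem exists_right_descent (hJ : J ⊆ S) {b : G} (hb : b ∈ Subgroup.closure J) (h1 : b ≠ 1) :
    ∃ r ∈ J, wordLength S (b * r) < wordLength S b := by
  obtain ⟨l, hl, hp, hlen⟩ := h.exists_reduced_of_mem_closure hJ hb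
  induction l using List.reverseRecOn with
  | nil => exact absurd (by simpa using hp.symm) h1
  | append_singleton l r _ =>
    have hr : r ∈ J := hl r (by simp)
    refine ⟨r, hr, ?_⟩
    rw [← hlen, ← hp, List.prod_append, List.prod_singleton, h.mul_mul_self (hJ hr)]
    exact (wordLength_le fun s hs => hJ (hl s (by simp [hs]))).trans_lt (by simp)

/-- Local minimality implies minimality in the coset. If the shortest element is `a * c` with `c ≠
1`, then `a = (a * c) * c⁻¹` with additive lengths, and a right descent `r ∈ J` of `c⁻¹` is one of
`a`. -/
theorem length_le_mul_of_mem_quotient (hJ : J ⊆ S) {a : G} (ha : a ∈ parabolicQuotient S J)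
    {b : G} (hb : b ∈ Subgroup.closure J) : wordLength S a ≤ wordLength S (a * b) := by
  obtain ⟨c, hc, hmin⟩ : ∃ c ∈ Subgroup.closure J, ∀ d ∈ Subgroup.closure J,
      wordLength S (a * c) ≤ wordLength S (a * d) := by
    obtain ⟨c, hc, hmin⟩ := WellFounded.has_min
      (InvImage.wf (fun d : G => wordLength S (a * d)) Nat.lt_wfRel.wf)
      (Subgroup.closure J : Set G) ⟨1, one_mem _⟩
    exact ⟨c, hc, fun d hd => not_lt.mp (hmin d hd)⟩
  have hadd := fun d hd => h.length_mul_of_minimal hJ (a := a * c) (b := d)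
    (fun d hd => by rw [mul_assoc]; exact hmin _ (mul_mem hc hd)) hd
  by_cases hc1 : c = 1
  · subst hc1
    simpa using hmin b hb
  · obtain ⟨r, hr, hlt⟩ := h.exists_right_descent hJ (inv_mem hc) (inv_ne_one.mpr hc1)
    have h2 := hadd _ (inv_mem hc)
    have h3 := hadd _ (mul_mem (inv_mem hc) (Subgroup.subset_closure hr))
    rw [mul_inv_cancel_right] at h2
    rw [← mul_assoc, mul_inv_cancel_right] at h3
    have := ha r hr
    omega

theorem length_mul_of_mem_quotient (hJ : J ⊆ S) {a : G} (ha : a ∈ parabolicQuotient S J) {b : G}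
    (hb : b ∈ Subgroup.closure J) :
    wordLength S (a * b) = wordLength S a + wordLength S b :=
  h.length_mul_of_minimal hJ (fun _ hd => h.length_le_mul_of_mem_quotient hJ ha hd) hb

theorem exists_factorization (hJ : J ⊆ S) (w : G) :
    ∃ a ∈ parabolicQuotient S J, ∃ b ∈ Subgroup.closure J, w = a * b := by
  induction hk : wordLength S w using Nat.strong_induction_on generalizing w with
  | _ k ih =>
    subst hk
    by_cases hw : w ∈ parabolicQuotient S J
    · exact ⟨w, hw, 1, one_mem _, (mul_one w).symm⟩
    · simp only [parabolicQuotient, Set.mem_ofPred_eq, not_forall] at hw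
      obtain ⟨r, hr, hlt⟩ := hw
      have hlt' := (h.lt_or_gt w (hJ hr)).resolve_left hlt
      obtain ⟨a, ha, b, hb, he⟩ := ih _ hlt' _ rfl
      refine ⟨a, ha, b * r, mul_mem hb (Subgroup.subset_closure hr), ?_⟩
      rw [← mul_assoc, ← he, h.mul_mul_self (hJ hr)]

theorem factorization_unique (hJ : J ⊆ S) {a a' b b' : G} (ha : a ∈ parabolicQuotient S J)
    (ha' : a' ∈ parabolicQuotient S J) (hb : b ∈ Subgroup.closure J)
    (hb' : b' ∈ Subgroup.closure J) (he : a * b = a' * b') : a = a' ∧ b = b' := by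
  have h1 : a' * (b' * b⁻¹) = a := by rw [← mul_assoc, ← he, mul_inv_cancel_right]
  have h2 : a * (b * b'⁻¹) = a' := by rw [← mul_assoc, he, mul_inv_cancel_right]
  have h3 := h.length_mul_of_mem_quotient hJ ha' (mul_mem hb' (inv_mem hb))
  have h4 := h.length_mul_of_mem_quotient hJ ha (mul_mem hb (inv_mem hb'))
  rw [h1] at h3
  rw [h2] at h4
  -- By `h3` and `h4` each of `a`, `a'` is at least as long as the other, so the correcting factors
  -- have length `0`.
  have h5 : b * b'⁻¹ = 1 := h.length_eq_zero.mp (by omega)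
  have h6 : b = b' := mul_inv_eq_one.mp h5
  subst h6
  exact ⟨mul_right_cancel he, rfl⟩

/-- Permits induction within `W^J` by stripping generators from the left. -/
theorem mem_quotient_of_left_descent (hJ : J ⊆ S) {a s : G} (hs : s ∈ S)
    (ha : a ∈ parabolicQuotient S J) (hlt : wordLength S (s * a) < wordLength S a) :
    s * a ∈ parabolicQuotient S J := by
  intro r hr
  have h1 := h.length_of_mul_left_lt hs hlt
  have h2 := h.length_mul_of_lt (hJ hr) (ha r hr)
  have h3 := h.length_mul_left_le (s * a * r) hs
  rw [mul_assoc, h.self_mul_mul hs] at h3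
  rw [mul_assoc]
  omega

/-- By additivity of length each letter of a reduced word of `b` raises both sides, so
`mul_le_mul_iff` cancels it. The next theorem cancels `a` in the same way from the left. -/
theorem mul_le_mul_iff_of_mem_quotient (hJ : J ⊆ S) {a a' b : G}
    (ha : a ∈ parabolicQuotient S J) (ha' : a' ∈ parabolicQuotient S J)
    (hb : b ∈ Subgroup.closure J) : BruhatLE S (a * b) (a' * b) ↔ BruhatLE S a a' := by
  refine h.closure_induction_right hJ (p := fun b =>
    BruhatLE S (a * b) (a' * b) ↔ BruhatLE S a a') (by simp) ?_ hb
  intro c hc r hr hlt ih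
  have hm : c * r ∈ Subgroup.closure J := mul_mem hc (Subgroup.subset_closure hr)
  have key : ∀ x ∈ parabolicQuotient S J, wordLength S (x * c) < wordLength S (x * c * r) := by
    intro x hx
    have h1 := h.length_mul_of_mem_quotient hJ hx hc
    have h2 := h.length_mul_of_mem_quotient hJ hx hm
    rw [← mul_assoc] at h2
    omega
  rw [← mul_assoc, ← mul_assoc, h.mul_le_mul_iff (hJ hr) (key a ha) (key a' ha'), ih]

theorem mul_le_mul_left_iff_of_mem_quotient (hJ : J ⊆ S) {a b b' : G}
    (ha : a ∈ parabolicQuotient S J) (hb : b ∈ Subgroup.closure J)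
    (hb' : b' ∈ Subgroup.closure J) : BruhatLE S (a * b) (a * b') ↔ BruhatLE S b b' := by
  induction hk : wordLength S a using Nat.strong_induction_on generalizing a with
  | _ k ih =>
    subst hk
    by_cases h1 : a = 1
    · simp [h1]
    · obtain ⟨s, hs, hlt⟩ := h.exists_left_descent h1
      have hm := h.mem_quotient_of_left_descent hJ hs ha hlt
      rw [← ih _ hlt hm rfl]
      have key : ∀ x ∈ Subgroup.closure J,
          wordLength S (s * a * x) < wordLength S (s * (s * a * x)) := by
        intro x hx
        rw [mul_assoc s a x, h.self_mul_mul hs, ← mul_assoc,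
          h.length_mul_of_mem_quotient hJ ha hx, h.length_mul_of_mem_quotient hJ hm hx]
        omega
      rw [← h.mul_le_mul_left_iff hs (key b hb) (key b' hb'), mul_assoc s a b, mul_assoc s a b',
        h.self_mul_mul hs, h.self_mul_mul hs]

/-! #### Gradedness -/

/-- This is gradedness of `W^J`; the case `J = ∅` gives that of `W`. A left descent `s` of `v`
either leaves `u ≤ s * v`, so that `s * v` lies between, or is also a descent of `u`, and induction
applies to `s * u ≤ s * v`. -/
theorem exists_between_of_mem_quotient (hJ : J ⊆ S) {u v : G} (hu : u ∈ parabolicQuotient S J)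
    (hv : v ∈ parabolicQuotient S J) (huv : BruhatLE S u v)
    (hlen : wordLength S u + 2 ≤ wordLength S v) :
    ∃ z ∈ parabolicQuotient S J, BruhatLE S u z ∧ BruhatLE S z v ∧ z ≠ u ∧ z ≠ v := by
  induction hk : wordLength S v using Nat.strong_induction_on generalizing u v with
  | _ k ih =>
    subst hk
    have hv1 : v ≠ 1 := by
      rintro rfl
      rw [wordLength_one] at hlen
      omega
    obtain ⟨s, hs, hlt⟩ := h.exists_left_descent hv1
    have hsv := h.mem_quotient_of_left_descent hJ hs hv hlt
    have hlv := h.length_of_mul_left_lt hs hlt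
    have hsvv : BruhatLE S (s * v) v := h.lift_top_left hs Relation.ReflTransGen.refl hlt
    have hne : s * v ≠ v := fun e => by rw [e] at hlt; omega
    have hneu : s * v ≠ u := fun e => by rw [e] at hlv; omega
    rcases h.lt_or_gt_left u hs with hsu | hsu
    · exact ⟨s * v, hsv, h.lift_down_left hs huv hsu, hsvv, hneu, hne⟩
    have hlu := h.length_of_mul_left_lt hs hsu
    obtain ⟨z, hz, hz1, hz2, hz3, hz4⟩ := ih _ hlt (h.mem_quotient_of_left_descent hJ hs hu hsu) hsv
      (h.lift_both_left hs huv hsu) (by omega) rfl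
    have hzlt : wordLength S z < wordLength S (s * v) := hz2.eq_or_length_lt.resolve_left hz4
    -- If the inductive element `z` already lies above `u`, then `s * v` serves, since `z ≤ s * v`.
    have fin : BruhatLE S u z → ∃ z ∈ parabolicQuotient S J,
        BruhatLE S u z ∧ BruhatLE S z v ∧ z ≠ u ∧ z ≠ v := by
      intro huz
      exact ⟨s * v, hsv, huz.trans hz2, hsvv, hneu, hne⟩
    rcases h.lt_or_gt_left z hs with hsz | hsz
    · have huz : BruhatLE S u (s * z) := by
        have := h.lift_up_left hs hz1 hsz
        rwa [h.self_mul_mul hs] at this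
      have hzv : BruhatLE S (s * z) v := by
        have := h.lift_up_left hs hz2 (by rwa [h.self_mul_mul hs])
        rwa [h.self_mul_mul hs] at this
      by_cases hq : s * z ∈ parabolicQuotient S J
      · refine ⟨s * z, hq, huz, hzv, ?_, ?_⟩
        · intro e; apply hz3; rw [← e, h.self_mul_mul hs]
        · intro e; apply hz4; rw [← e, h.self_mul_mul hs]
      · simp only [parabolicQuotient, Set.mem_ofPred_eq, not_forall] at hq
        obtain ⟨r, hr, hnlt⟩ := hq
        have hlt' := (h.lt_or_gt _ (hJ hr)).resolve_left hnlt
        apply fin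
        have h1 := h.lift_down (hJ hr) huz (hu r hr)
        refine h1.trans ?_
        -- When `s * z` leaves `W^J`, the element `s * z * r` still lies above `u`. It has the
        -- length of `z` and ascends under `s` to `z * r`, so lifting down from `s * z` puts it
        -- below `z`; hence `u ≤ z`.
        have h2 := h.lift_down_left hs (h.mul_le_of_lt (hJ hr) hlt')
        have h3 := h.length_mul_of_lt (hJ hr) (hz r hr)
        have h4 := h.length_mul_left_of_lt hs hsz
        have h5 := h.length_of_mul_lt (hJ hr) hlt'
        have h6 : wordLength S (s * z * r) < wordLength S (s * (s * z * r)) := by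
          rw [mul_assoc s z r, h.self_mul_mul hs, ← mul_assoc]
          omega
        have h7 := h2 h6
        rw [h.self_mul_mul hs] at h7
        exact h7
    · apply fin
      have := h.lift_top_left hs hz1 hsz
      rwa [h.self_mul_mul hs] at this

theorem exists_between {u v : G} (huv : BruhatLE S u v)
    (hlen : wordLength S u + 2 ≤ wordLength S v) :
    ∃ z, BruhatLE S u z ∧ BruhatLE S z v ∧ z ≠ u ∧ z ≠ v := by
  obtain ⟨z, -, hz⟩ := h.exists_between_of_mem_quotient (Set.empty_subset S)
    (u := u) (v := v) (by simp [parabolicQuotient]) (by simp [parabolicQuotient]) huv hlen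
  exact ⟨z, hz⟩

theorem exists_top_of_closure [Finite G] (hJ : J ⊆ S) :
    ∃ m ∈ Subgroup.closure J, ∀ b ∈ Subgroup.closure J, BruhatLE S b m := by
  obtain ⟨m, hm, hmax⟩ := Set.exists_max_image (Subgroup.closure J : Set G) (wordLength S)
    (Set.toFinite _) ⟨1, one_mem _⟩
  refine ⟨m, hm, fun b hb => ?_⟩
  refine h.closure_induction_right hJ (p := fun b => BruhatLE S b m) (h.one_le m) ?_ hb
  intro c _ r hr _ ih
  refine h.lift_top (hJ hr) ih ((h.lt_or_gt m (hJ hr)).resolve_left (not_lt.mpr ?_))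
  exact hmax _ (mul_mem hm (Subgroup.subset_closure hr))

theorem exists_top [Finite G] : ∃ m, ∀ w, BruhatLE S w m := by
  obtain ⟨m, -, hm⟩ := h.exists_top_of_closure (J := S) le_rfl
  exact ⟨m, fun w => hm w (by rw [h.closure_eq]; trivial)⟩

/-- The maximum of `W` factors as `m * b`. Each letter of `b` can be stripped while staying above
`a`, because elements of `W^J` ascend under every `r ∈ J`. -/
theorem exists_top_of_quotient [Finite G] (hJ : J ⊆ S) :
    ∃ m ∈ parabolicQuotient S J, ∀ a ∈ parabolicQuotient S J, BruhatLE S a m := by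
  obtain ⟨w, hw⟩ := h.exists_top
  obtain ⟨m, hm, b, hb, rfl⟩ := h.exists_factorization hJ w
  refine ⟨m, hm, fun a ha => ?_⟩
  refine h.closure_induction_right hJ (p := fun b => BruhatLE S a (m * b) → BruhatLE S a m)
    (by simp) ?_ hb (hw a)
  intro c _ r hr _ ih hle
  apply ih
  have := h.lift_down (hJ hr) hle (ha r hr)
  rwa [← mul_assoc, h.mul_mul_self (hJ hr)] at this

theorem one_mem_quotient (hJ : J ⊆ S) (h1 : (1 : G) ∉ S) : (1 : G) ∈ parabolicQuotient S J := by
  intro r hr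
  rw [wordLength_one, one_mul]
  exact Nat.pos_of_ne_zero fun h0 => h1 (by rw [← h.length_eq_zero.mp h0]; exact hJ hr)

end IsInversionCocycle

end Coxeter
/-! ### Signed permutations -/

namespace PlusMinus

variable {n : ℕ}

theorem neg_val (x : PlusMinus n) : (-x).1 = -x.1 := rfl

theorem pos_val (i : Fin n) : (pos i).1 = (i : ℤ) + 1 := rfl

/-- The index `i` such that `x = ± pos i`. -/
def index (x : PlusMinus n) : Fin n :=
  ⟨x.1.natAbs - 1, by have h1 := x.2.1; have h2 := abs_le.mp x.2.2; omega⟩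

theorem index_val (x : PlusMinus n) : ((index x : Fin n) : ℤ) + 1 = |x.1| := by
  have h1 := x.2.1
  rw [Int.abs_eq_natAbs]
  simp only [index]
  omega

theorem index_pos (i : Fin n) : index (pos i) = i := by
  apply Fin.ext
  simp only [index, pos_val]
  omega

theorem index_neg (x : PlusMinus n) : index (-x) = index x := by
  apply Fin.ext
  simp only [index, neg_val]
  omega

theorem eq_pos_index {x : PlusMinus n} (hx : 0 < x.1) : x = pos (index x) := by
  apply Subtype.ext
  rw [pos_val, index_val, abs_of_pos hx]

theorem eq_neg_pos_index {x : PlusMinus n} (hx : x.1 < 0) : x = -pos (index x) := by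
  apply Subtype.ext
  rw [neg_val, pos_val, index_val, abs_of_neg hx, neg_neg]

theorem pos_or_neg (x : PlusMinus n) : 0 < x.1 ∨ x.1 < 0 := by
  have := x.2.1
  omega

theorem neg_neg' (x : PlusMinus n) : - -x = x := neg_neg x

end PlusMinus

namespace SignedPerm

open PlusMinus

variable {n : ℕ}

theorem map_neg (w : SignedPerm n) (x : PlusMinus n) : w.1 (-x) = -w.1 x := w.2 x

theorem map_neg_val (w : SignedPerm n) (x : PlusMinus n) : (w.1 (-x)).1 = -(w.1 x).1 := by
  rw [map_neg, neg_val]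

theorem mul_apply (u v : SignedPerm n) (x : PlusMinus n) : (u * v).1 x = u.1 (v.1 x) := rfl

theorem inv_apply_self (w : SignedPerm n) (x : PlusMinus n) : w⁻¹.1 (w.1 x) = x := by
  rw [← mul_apply, inv_mul_cancel]; rfl

theorem apply_inv_self (w : SignedPerm n) (x : PlusMinus n) : w.1 (w⁻¹.1 x) = x := by
  rw [← mul_apply, mul_inv_cancel]; rfl

theorem val_injective (w : SignedPerm n) {x y : PlusMinus n} (h : (w.1 x).1 = (w.1 y).1) :
    x = y :=
  w.1.injective (Subtype.ext h)

theorem ext_window {u v : SignedPerm n} (h : ∀ i, window u i = window v i) : u = v := by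
  have h' : ∀ i, u.1 (pos i) = v.1 (pos i) := fun i => Subtype.ext (h i)
  apply Subtype.ext
  ext x : 1
  rcases pos_or_neg x with hx | hx
  · rw [eq_pos_index hx, h']
  · rw [eq_neg_pos_index hx, map_neg, map_neg, h']

theorem window_ne_zero (w : SignedPerm n) (i : Fin n) : window w i ≠ 0 := (w.1 (pos i)).2.1

theorem simple_val_zero {i : Fin n} (hi : (i : ℕ) = 0) (x : PlusMinus n) :
    ((simple i).1 x).1 = if x.1 = 1 ∨ x.1 = -1 then -x.1 else x.1 := by
  simp only [simple, hi, dif_pos, signChange, Equiv.swap_apply_def, Subtype.ext_iff]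
  split_ifs <;> simp only [neg_val, pos_val] at * <;> omega

theorem simple_val_ne_zero {i : Fin n} (hi : (i : ℕ) ≠ 0) (x : PlusMinus n) :
    ((simple i).1 x).1 = if x.1 = i then (i : ℤ) + 1 else if x.1 = i + 1 then (i : ℤ) else
      if x.1 = -i then -(i + 1 : ℤ) else if x.1 = -(i + 1) then -(i : ℤ) else x.1 := by
  simp only [simple, hi, dif_neg, not_false_eq_true, exchange, Equiv.Perm.mul_apply,
    Equiv.swap_apply_def, Subtype.ext_iff]
  split_ifs <;> simp only [neg_val, pos_val] at * <;> omega

theorem simple_mul_self (i : Fin n) : simple i * simple i = 1 := by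
  apply Subtype.ext
  ext x
  rw [mul_apply]
  change _ = x.1
  have hx := x.2.1
  by_cases hi : (i : ℕ) = 0
  · rw [simple_val_zero hi, simple_val_zero hi]
    split_ifs <;> omega
  · rw [simple_val_ne_zero hi, simple_val_ne_zero hi]
    split_ifs <;> omega

/-! ### Reflections as pair swaps, and inversions of signed permutations. -/

/-- `t` is an involution moving only `±x` and `±t x`, for some `x`. -/
def IsPairSwap (t : SignedPerm n) : Prop :=
  (∀ x, t.1 (t.1 x) = x) ∧
    ∀ x, t.1 x ≠ x → ∀ z, z = x ∨ z = t.1 x ∨ z = -x ∨ z = -t.1 x ∨ t.1 z = z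

theorem IsPairSwap.conj {t : SignedPerm n} (ht : IsPairSwap t) (w : SignedPerm n) :
    IsPairSwap (w * t * w⁻¹) := by
  constructor
  · intro x
    simp only [mul_apply, inv_apply_self, ht.1, apply_inv_self]
  · intro x hx z
    simp only [mul_apply] at hx ⊢
    have hx' : t.1 (w⁻¹.1 x) ≠ w⁻¹.1 x := fun h => hx (by rw [h, apply_inv_self])
    have e : z = w.1 (w⁻¹.1 z) := (apply_inv_self w z).symm
    rcases ht.2 _ hx' (w⁻¹.1 z) with h | h | h | h | h
    · left; rw [e, h, apply_inv_self]
    · right; left; rw [e, h]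
    · right; right; left; rw [e, h, map_neg, apply_inv_self]
    · right; right; right; left; rw [e, h, map_neg]
    · right; right; right; right; rw [h, apply_inv_self]

theorem isPairSwap_simple (i : Fin n) : IsPairSwap (simple i) := by
  constructor
  · intro x
    rw [← mul_apply, simple_mul_self]; rfl
  · intro x hx z
    have hx0 := x.2.1
    have hz0 := z.2.1
    simp only [Subtype.ext_iff, neg_val, ne_eq] at hx ⊢
    by_cases hi : (i : ℕ) = 0
    · rw [simple_val_zero hi] at *
      rw [simple_val_zero hi]
      split_ifs at * <;> omega
    · rw [simple_val_ne_zero hi] at *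
      rw [simple_val_ne_zero hi]
      split_ifs at * <;> omega

theorem isPairSwap_of_mem_reflections {t : SignedPerm n} (ht : t ∈ reflections (generators n)) :
    IsPairSwap t := by
  obtain ⟨w, _, ⟨i, rfl⟩, rfl⟩ := ht
  exact (isPairSwap_simple i).conj w

theorem IsPairSwap.eq_of_apply_eq {t s : SignedPerm n} (ht : IsPairSwap t) (hs : IsPairSwap s)
    {x : PlusMinus n} (hx : t.1 x ≠ x) (h : t.1 x = s.1 x) : t = s := by
  apply Subtype.ext
  ext z : 1
  have h1 := ht.2 x hx z
  have h2 := hs.2 x (h ▸ hx) z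
  rw [← h] at h2
  have e : s.1 (t.1 x) = x := by rw [h, hs.1]
  by_cases c1 : z = x
  · rw [c1, h]
  by_cases c2 : z = t.1 x
  · rw [c2, ht.1, e]
  by_cases c3 : z = -x
  · rw [c3, map_neg, map_neg, h]
  by_cases c4 : z = -t.1 x
  · rw [c4, map_neg, map_neg, ht.1, e]
  rw [show t.1 z = z by tauto, show s.1 z = z by tauto]

/-- `t` is an inversion of `w`: some `x < t x` has `w (t x) < w x`. -/
def IsInversion (w t : SignedPerm n) : Prop :=
  ∃ x : PlusMinus n, x.1 < (t.1 x).1 ∧ (w.1 (t.1 x)).1 < (w.1 x).1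

/-- Besides `x`, only `-t x` is a moved point that `t` increases, and by oddness it gives the same
inequality. Any single witness therefore decides. -/
theorem IsPairSwap.isInversion_iff {t : SignedPerm n} (ht : IsPairSwap t) (w : SignedPerm n)
    {x : PlusMinus n} (hx : x.1 < (t.1 x).1) :
    IsInversion w t ↔ (w.1 (t.1 x)).1 < (w.1 x).1 := by
  refine ⟨?_, fun h => ⟨x, hx, h⟩⟩
  rintro ⟨y, hy, hlt⟩
  have hne : t.1 x ≠ x := fun h => by rw [h] at hx; omega
  rcases ht.2 x hne y with rfl | rfl | rfl | rfl | h
  · exact hlt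
  · rw [ht.1] at hy; omega
  · rw [map_neg_val, neg_val] at hy; omega
  · rw [map_neg, ht.1, map_neg_val, map_neg_val] at hlt; omega
  · rw [h] at hy; omega

/-- A generator exchanges neighbours in `[±n]`, so it reverses no pair other than those it swaps.
This is what produces the cocycle rule below. -/
theorem simple_eq_of_reverses (i : Fin n) {x y : PlusMinus n} (hxy : x.1 < y.1)
    (h : ((simple i).1 y).1 < ((simple i).1 x).1) : y = (simple i).1 x := by
  have hx := x.2.1
  have hy := y.2.1
  apply Subtype.ext
  by_cases hi : (i : ℕ) = 0
  · rw [simple_val_zero hi] at *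
    rw [simple_val_zero hi] at h
    split_ifs at * <;> omega
  · rw [simple_val_ne_zero hi] at *
    rw [simple_val_ne_zero hi] at h
    split_ifs at * <;> omega

theorem exists_lt_simple (i : Fin n) : ∃ x : PlusMinus n, x.1 < ((simple i).1 x).1 := by
  by_cases hi : (i : ℕ) = 0
  · refine ⟨-pos i, ?_⟩
    rw [simple_val_zero hi, neg_val, pos_val]
    split_ifs <;> omega
  · refine ⟨pos ⟨(i : ℕ) - 1, by omega⟩, ?_⟩
    rw [simple_val_ne_zero hi, pos_val]
    simp only
    split_ifs <;> omega

/-- For `t = s` the two values compared trade places. For `t ≠ s` the generator `s` keeps `x` and `t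
x` in order, so `x ↦ s x` matches the witnesses on both sides. -/
theorem isInversion_mul_simple (w : SignedPerm n) (i : Fin n) {t : SignedPerm n}
    (ht : IsPairSwap t) :
    IsInversion (w * simple i) t ↔ (t = simple i ↔ ¬ IsInversion w (simple i * t * simple i)) := by
  set s := simple i with hsdef
  have hs : IsPairSwap s := isPairSwap_simple i
  have hss : s * s = 1 := simple_mul_self i
  by_cases hts : t = s
  · subst hts
    obtain ⟨x, hx⟩ := exists_lt_simple i
    rw [← hsdef] at hx
    rw [hss, one_mul, hs.isInversion_iff _ hx, hs.isInversion_iff _ hx]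
    simp only [mul_apply, hs.1]
    have : (s.1 x) ≠ x := fun h => by rw [h] at hx; omega
    have h2 : (w.1 (s.1 x)).1 ≠ (w.1 x).1 := fun h => this (val_injective w h)
    simp only [true_iff, not_lt]
    omega
  · simp only [hts, false_iff, not_not]
    constructor
    · rintro ⟨x, hx, hlt⟩
      rw [mul_apply, mul_apply] at hlt
      refine ⟨s.1 x, ?_, ?_⟩
      · simp only [mul_apply, hs.1]
        by_contra hcon
        have hne : (s.1 (t.1 x)).1 ≠ (s.1 x).1 := fun h => by
          have := val_injective s h
          rw [this] at hx; omega
        have := simple_eq_of_reverses i hx (by rw [← hsdef]; omega)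
        exact hts (ht.eq_of_apply_eq hs (fun h => by rw [h] at hx; omega) this)
      · simp only [mul_apply, hs.1]
        exact hlt
    · rintro ⟨y, hy, hlt⟩
      simp only [mul_apply] at hy hlt
      refine ⟨s.1 y, ?_, ?_⟩
      · by_contra hcon
        have hne : (t.1 (s.1 y)).1 ≠ (s.1 y).1 := fun h => by
          have := Subtype.ext h
          rw [this, hs.1] at hy; omega
        have := simple_eq_of_reverses i hy (by rw [← hsdef, hs.1]; omega)
        rw [← hsdef] at this
        have h2 : t.1 (s.1 y) = s.1 (s.1 y) := s.1.injective (by rw [this, hs.1])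
        exact hts (ht.eq_of_apply_eq hs (fun h => hne (by rw [h])) h2)
      · simp only [mul_apply, hs.1]
        exact hlt

/-! #### Permutations as signed permutations -/

/-- The signed permutation with window `(τ(1), …, τ(n))`. -/
def ofPerm : Equiv.Perm (Fin n) →* SignedPerm n where
  toFun τ :=
    ⟨{ toFun := fun x => if 0 < x.1 then pos (τ (index x)) else -pos (τ (index x))
       invFun := fun x => if 0 < x.1 then pos (τ.symm (index x)) else -pos (τ.symm (index x))
       left_inv := by
        intro x
        rcases pos_or_neg x with hx | hx
        · have h1 : 0 < (pos (τ (index x))).1 := by rw [pos_val]; omega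
          simp only [hx, if_true, h1, index_pos, Equiv.symm_apply_apply]
          exact (eq_pos_index hx).symm
        · have h1 : ¬ 0 < (-pos (τ (index x))).1 := by rw [neg_val, pos_val]; omega
          simp only [not_lt.mpr hx.le, if_false, h1, index_neg, index_pos,
            Equiv.symm_apply_apply]
          exact (eq_neg_pos_index hx).symm
       right_inv := by
        intro x
        rcases pos_or_neg x with hx | hx
        · have h1 : 0 < (pos (τ.symm (index x))).1 := by rw [pos_val]; omega
          simp only [hx, if_true, h1, index_pos, Equiv.apply_symm_apply]
          exact (eq_pos_index hx).symm
        · have h1 : ¬ 0 < (-pos (τ.symm (index x))).1 := by rw [neg_val, pos_val]; omega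
          simp only [not_lt.mpr hx.le, if_false, h1, index_neg, index_pos,
            Equiv.apply_symm_apply]
          exact (eq_neg_pos_index hx).symm },
     by
      intro x
      simp only [Equiv.coe_fn_mk, index_neg, neg_val]
      rcases pos_or_neg x with hx | hx
      · rw [if_neg (by omega), if_pos hx]
      · rw [if_pos (by omega), if_neg (by omega), neg_neg']⟩
  map_one' := by
    apply ext_window
    intro i
    simp only [window, Equiv.coe_fn_mk, index_pos, pos_val]
    rw [if_pos (by omega)]
    rfl
  map_mul' σ τ := by
    apply ext_window
    intro i
    simp only [window, mul_apply, Equiv.coe_fn_mk, index_pos, pos_val]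
    have h1 : ∀ k : Fin n, (0 : ℤ) < (k : ℤ) + 1 := fun k => by omega
    simp only [h1, if_true, index_pos, pos_val]
    rfl

theorem ofPerm_pos (τ : Equiv.Perm (Fin n)) (i : Fin n) : (ofPerm τ).1 (pos i) = pos (τ i) := by
  simp only [ofPerm, MonoidHom.coe_mk, OneHom.coe_mk, Equiv.coe_fn_mk, index_pos, pos_val]
  rw [if_pos (by omega)]

theorem window_ofPerm (τ : Equiv.Perm (Fin n)) (i : Fin n) :
    window (ofPerm τ) i = ((τ i : ℕ) : ℤ) + 1 := by
  rw [window, ofPerm_pos, pos_val]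

theorem window_mul_ofPerm (w : SignedPerm n) (τ : Equiv.Perm (Fin n)) (i : Fin n) :
    window (w * ofPerm τ) i = window w (τ i) := by
  rw [window, mul_apply, ofPerm_pos, window]

theorem ofPerm_injective : Function.Injective (ofPerm (n := n)) := by
  intro σ τ h
  ext i
  have := window_ofPerm σ i
  rw [h, window_ofPerm] at this
  omega

theorem index_window_injective (w : SignedPerm n) :
    Function.Injective fun i => index (w.1 (pos i)) := by
  intro i j h
  have h1 : |(w.1 (pos i)).1| = |(w.1 (pos j)).1| := by
    rw [← index_val, ← index_val, show index (w.1 (pos i)) = index (w.1 (pos j)) from h]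
  rcases abs_eq_abs.mp h1 with h2 | h2
  · have := congrArg Subtype.val (val_injective w h2)
    rw [pos_val, pos_val] at this
    apply Fin.ext; omega
  · rw [← map_neg_val] at h2
    have := congrArg Subtype.val (val_injective w h2)
    rw [neg_val, pos_val, pos_val] at this
    omega

/-- The permutation `i ↦ |w i|` underlying a signed permutation. -/
noncomputable def absPerm (w : SignedPerm n) : Equiv.Perm (Fin n) :=
  Equiv.ofBijective _ (Finite.injective_iff_bijective.mp (index_window_injective w))

theorem absPerm_apply (w : SignedPerm n) (i : Fin n) : absPerm w i = index (w.1 (pos i)) := rfl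

theorem ofPerm_absPerm {w : SignedPerm n} (hw : ∀ i, 0 < window w i) : ofPerm (absPerm w) = w := by
  apply ext_window
  intro i
  rw [window_ofPerm, absPerm_apply, index_val, ← window, abs_of_pos (hw i)]

theorem simple_eq_ofPerm (i : Fin n) (hi : (i : ℕ) ≠ 0) :
    simple i = ofPerm (Equiv.swap ⟨(i : ℕ) - 1, by omega⟩ i) := by
  apply ext_window
  intro j
  rw [window_ofPerm, window, simple_val_ne_zero hi, pos_val, Equiv.swap_apply_def]
  simp only [Fin.ext_iff]
  split_ifs <;> (try simp only) <;> omega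

theorem range_ofPerm : (ofPerm (n := n)).range = parabolicJ n := by
  apply le_antisymm
  · rintro _ ⟨τ, rfl⟩
    rcases n with _ | n
    · rw [Subsingleton.elim τ 1, map_one]; exact one_mem _
    · have hτ : τ ∈ Submonoid.closure
          (Set.range fun i : Fin n => Equiv.swap i.castSucc i.succ) := by
        rw [Equiv.Perm.mclosure_swap_castSucc_succ]; trivial
      induction hτ using Submonoid.closure_induction with
      | mem x hx =>
        obtain ⟨i, rfl⟩ := hx
        refine Subgroup.subset_closure ⟨i.succ, by simp, ?_⟩
        rw [simple_eq_ofPerm _ (by simp)]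
        congr 2
      | one => rw [map_one]; exact one_mem _
      | mul x y _ _ hx hy => rw [map_mul]; exact mul_mem hx hy
  · rw [parabolicJ, Subgroup.closure_le]
    rintro _ ⟨i, hi, rfl⟩
    exact ⟨_, (simple_eq_ofPerm i hi).symm⟩

theorem ofPerm_mem (τ : Equiv.Perm (Fin n)) : ofPerm τ ∈ parabolicJ n := by
  rw [← range_ofPerm]; exact ⟨τ, rfl⟩

theorem mem_parabolicJ_of_window_pos {w : SignedPerm n} (hw : ∀ i, 0 < window w i) :
    w ∈ parabolicJ n := by
  rw [← ofPerm_absPerm hw]; exact ofPerm_mem _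

/-- The identification of `S_n` with `W_J`. -/
noncomputable def permEquiv (n : ℕ) : Equiv.Perm (Fin n) ≃* parabolicJ n :=
  (MonoidHom.ofInjective ofPerm_injective).trans (MulEquiv.subgroupCongr range_ofPerm)

theorem coe_permEquiv (τ : Equiv.Perm (Fin n)) : (permEquiv n τ : SignedPerm n) = ofPerm τ := rfl

/-! #### The sum of the positions of the negative entries -/

/-- The sum of the `k ∈ [n]` with `v(k) < 0`. -/
def negPositionSum (v : SignedPerm n) : ℤ :=
  ∑ k : Fin n, if window v k < 0 then (k : ℤ) + 1 else 0

theorem negPositionSum_nonneg (v : SignedPerm n) : 0 ≤ negPositionSum v :=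
  Finset.sum_nonneg fun k _ => by split_ifs <;> omega

theorem window_inv_neg_iff (w : SignedPerm n) (i : Fin n) :
    window w⁻¹ (absPerm w i) < 0 ↔ window w i < 0 := by
  rw [window, absPerm_apply]
  have h0 : (w.1 (pos i)).1 = window w i := rfl
  rcases pos_or_neg (w.1 (pos i)) with h | h
  · rw [← eq_pos_index h, inv_apply_self, pos_val]; omega
  · have h2 : pos (index (w.1 (pos i))) = -w.1 (pos i) := by
      conv_rhs => rw [eq_neg_pos_index h]
      exact (neg_neg' _).symm
    rw [h2, map_neg_val, inv_apply_self, pos_val]; omega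

/-- The negative entries of `w⁻¹` stand at the positions `|w(i)|` with `w(i) < 0`. The sum in `nmaj`
becomes a statistic of positions, which right multiplication by generators changes in a controlled
way. -/
theorem negPositionSum_inv (w : SignedPerm n) :
    negPositionSum w⁻¹ = -∑ i : Fin n, if window w i < 0 then window w i else 0 := by
  rw [negPositionSum, ← Equiv.sum_comp (absPerm w), ← Finset.sum_neg_distrib]
  refine Finset.sum_congr rfl fun i _ => ?_
  simp only [window_inv_neg_iff]
  split_ifs with h
  · rw [absPerm_apply, index_val]
    exact abs_of_neg h
  · simp

theorem negPositionSum_mul_simple_zero (v : SignedPerm n) {i : Fin n} (hi : (i : ℕ) = 0) :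
    negPositionSum (v * simple i) = negPositionSum v + if window v i < 0 then -1 else 1 := by
  have key : ∀ k : Fin n, (if window (v * simple i) k < 0 then (k : ℤ) + 1 else 0) =
      (if window v k < 0 then (k : ℤ) + 1 else 0) +
        if k = i then (if window v k < 0 then -1 else 1) else 0 := by
    intro k
    have h0 := window_ne_zero v k
    by_cases hk : k = i
    · subst hk
      have h1 : (simple k).1 (pos k) = -pos k := by
        apply Subtype.ext
        rw [simple_val_zero hi, pos_val, neg_val, pos_val]
        split_ifs <;> omega
      have h2 : window (v * simple k) k = -window v k := by
        rw [window, mul_apply, h1, map_neg_val, window]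
      rw [h2]
      split_ifs <;> omega
    · have hk' : (k : ℕ) ≠ 0 := fun h => hk (Fin.ext (by omega))
      have h1 : (simple i).1 (pos k) = pos k := by
        apply Subtype.ext
        rw [simple_val_zero hi, pos_val]
        split_ifs <;> omega
      have h2 : window (v * simple i) k = window v k := by
        rw [window, mul_apply, h1, window]
      rw [h2, if_neg hk, add_zero]
  simp only [negPositionSum, key, Finset.sum_add_distrib, Finset.sum_ite_eq', Finset.mem_univ,
    if_true]

theorem negPositionSum_mul_simple_ne_zero (v : SignedPerm n) {i : Fin n} (hi : (i : ℕ) ≠ 0) :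
    negPositionSum (v * simple i) = negPositionSum v +
      (if window v ⟨(i : ℕ) - 1, by omega⟩ < 0 then 1 else 0) - if window v i < 0 then 1 else 0 := by
  set j : Fin n := ⟨(i : ℕ) - 1, by omega⟩ with hj
  have hji : j ≠ i := fun h => by
    have := congrArg Fin.val h
    simp only [hj] at this
    omega
  have e : negPositionSum (v * simple i) =
      ∑ k : Fin n, if window v k < 0 then ((Equiv.swap j i k : Fin n) : ℤ) + 1 else 0 := by
    rw [negPositionSum, simple_eq_ofPerm i hi, ← Equiv.sum_comp (Equiv.swap j i)]
    refine Finset.sum_congr rfl fun k _ => ?_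
    rw [window_mul_ofPerm, Equiv.swap_apply_self]
  have key : ∀ k : Fin n,
      (if window v k < 0 then ((Equiv.swap j i k : Fin n) : ℤ) + 1 else 0) =
      (if window v k < 0 then (k : ℤ) + 1 else 0) +
        (if k = j then (if window v k < 0 then 1 else 0) else 0) -
        if k = i then (if window v k < 0 then 1 else 0) else 0 := by
    intro k
    by_cases h1 : k = j
    · rw [h1, Equiv.swap_apply_left, if_neg hji, if_pos rfl]
      have : ((j : Fin n) : ℤ) = (i : ℤ) - 1 := by simp only [hj]; omega
      split_ifs <;> omega
    · by_cases h2 : k = i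
      · rw [h2, Equiv.swap_apply_right, if_neg hji.symm, if_pos rfl]
        have : ((j : Fin n) : ℤ) = (i : ℤ) - 1 := by simp only [hj]; omega
        split_ifs <;> omega
      · rw [Equiv.swap_apply_of_ne_of_ne h1 h2, if_neg h1, if_neg h2]
        simp
  rw [e]
  simp only [negPositionSum, key, Finset.sum_add_distrib, Finset.sum_sub_distrib,
    Finset.sum_ite_eq', Finset.mem_univ, if_true]

theorem negPositionSum_mul_simple_le (v : SignedPerm n) (i : Fin n) :
    negPositionSum (v * simple i) ≤ negPositionSum v + 1 := by
  by_cases hi : (i : ℕ) = 0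
  · rw [negPositionSum_mul_simple_zero v hi]
    split_ifs <;> omega
  · rw [negPositionSum_mul_simple_ne_zero v hi]
    split_ifs <;> omega

/-- The leftmost negative entry is made positive by `s_0` if it stands first, and otherwise moves
one place left past a positive entry. -/
theorem exists_negPositionSum_lt {v : SignedPerm n} (h : ∃ k, window v k < 0) :
    ∃ i : Fin n, negPositionSum (v * simple i) = negPositionSum v - 1 := by
  obtain ⟨i, hi, hmin⟩ := WellFounded.has_min (Nat.lt_wfRel.wf.onFun (f := (Fin.val : Fin n → ℕ)))
    {k | window v k < 0} h
  change window v i < 0 at hi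
  refine ⟨i, ?_⟩
  by_cases h0 : (i : ℕ) = 0
  · rw [negPositionSum_mul_simple_zero v h0, if_pos hi]; rfl
  · rw [negPositionSum_mul_simple_ne_zero v h0, if_pos hi, if_neg, add_zero]
    intro hlt
    refine hmin _ hlt ?_
    change (i : ℕ) - 1 < i
    omega

theorem negPositionSum_prod_le (l : List (SignedPerm n)) (hl : ∀ s ∈ l, s ∈ generators n) :
    negPositionSum l.prod ≤ l.length := by
  induction l using List.reverseRecOn with
  | nil =>
    have : negPositionSum (1 : SignedPerm n) = 0 :=
      Finset.sum_eq_zero fun k _ => if_neg (by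
        change ¬ (pos k).1 < 0
        rw [pos_val]; omega)
    simp [this]
  | append_singleton l s ih =>
    obtain ⟨i, rfl⟩ := hl s (by simp)
    have := negPositionSum_mul_simple_le l.prod i
    have h2 := ih fun r hr => hl r (by simp [hr])
    simp only [List.prod_append, List.prod_singleton, List.length_append, List.length_singleton]
    push_cast
    omega

/-- Lowering the statistic one generator at a time ends at a window without negative entries, that
is, in `W_J`. -/
theorem exists_word (v : SignedPerm n) : ∃ b ∈ parabolicJ n, ∃ l : List (SignedPerm n),
    (∀ s ∈ l, s ∈ generators n) ∧ (l.length : ℤ) = negPositionSum v ∧ v = b * l.prod := by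
  induction hk : (negPositionSum v).toNat using Nat.strong_induction_on generalizing v with
  | _ k ih =>
    subst hk
    have h0 := negPositionSum_nonneg v
    by_cases hv : ∃ k, window v k < 0
    · obtain ⟨i, hi⟩ := exists_negPositionSum_lt hv
      have h1 := negPositionSum_nonneg (v * simple i)
      obtain ⟨b, hb, l, hl, hlen, he⟩ := ih _ (by omega) (v * simple i) rfl
      refine ⟨b, hb, l ++ [simple i], ?_, ?_, ?_⟩
      · intro s hs
        rcases List.mem_append.mp hs with h | h
        · exact hl s h
        · rw [List.mem_singleton.mp h]; exact ⟨i, rfl⟩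
      · rw [List.length_append, List.length_singleton]; push_cast; omega
      · rw [List.prod_append, List.prod_singleton, ← mul_assoc, ← he, mul_assoc, simple_mul_self,
          mul_one]
    · simp only [not_exists, not_lt] at hv
      refine ⟨v, mem_parabolicJ_of_window_pos fun i => lt_of_le_of_ne (hv i)
        (window_ne_zero v i).symm, [], by simp, ?_, by simp⟩
      rw [negPositionSum, Finset.sum_eq_zero fun k _ => if_neg (not_lt.mpr (hv k))]
      rfl

/-! ### The inversion cocycle of `S_n^B`, and length and windows on `W^J`. -/

theorem unsignedGenerators_subset (n : ℕ) : unsignedGenerators n ⊆ generators n := by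
  rintro _ ⟨i, -, rfl⟩
  exact ⟨i, rfl⟩

theorem isInversionCocycle (n : ℕ) : IsInversionCocycle (generators n) IsInversion where
  mul_self := by
    rintro _ ⟨i, rfl⟩
    exact simple_mul_self i
  closure_eq := by
    refine top_unique fun v _ => ?_
    obtain ⟨b, hb, l, hl, -, rfl⟩ := exists_word v
    exact mul_mem (Subgroup.closure_mono (unsignedGenerators_subset n) hb)
      (list_prod_mem_closure hl)
  not_inv_one := by
    rintro t - ⟨x, h1, h2⟩
    exact lt_asymm h1 h2
  inv_mul := by
    rintro w _ ⟨i, rfl⟩ t ht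
    exact isInversion_mul_simple w i (isPairSwap_of_mem_reflections ht)

theorem one_notMem_generators (n : ℕ) : (1 : SignedPerm n) ∉ generators n := by
  rintro ⟨i, hi⟩
  obtain ⟨x, hx⟩ := exists_lt_simple i
  rw [hi] at hx
  exact lt_irrefl _ hx

theorem negPositionSum_le_length (v : SignedPerm n) :
    negPositionSum v ≤ wordLength (generators n) v := by
  obtain ⟨l, hl, hS, rfl⟩ := (isInversionCocycle n).exists_reduced v
  rw [← hl]
  exact negPositionSum_prod_le l hS

/-- Each generator raises `negPositionSum` by at most one, which bounds the length of `a⁻¹` below.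
Conversely `exists_word` writes `a⁻¹ = b * l.prod`, so `l.prod` is the inverse of `a * b`, and `a`
is shortest in its coset. -/
theorem length_eq_of_mem_quotientJ {a : SignedPerm n} (ha : a ∈ quotientJ n) :
    (length a : ℤ) = -∑ i : Fin n, if window a i < 0 then window a i else 0 := by
  have h := isInversionCocycle n
  rw [← negPositionSum_inv]
  apply le_antisymm
  · obtain ⟨b, hb, l, hl, hlen, he⟩ := exists_word a⁻¹
    rw [← hlen, Nat.cast_le]
    have h1 := wordLength_le (S := generators n) hl
    have h2 := h.length_le_mul_of_mem_quotient (unsignedGenerators_subset n) ha hb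
    have h3 : l.prod = (a * b)⁻¹ := by rw [mul_inv_rev, he, inv_mul_cancel_left]
    rw [h3, h.length_inv] at h1
    exact h2.trans h1
  · have := negPositionSum_le_length a⁻¹
    rwa [h.length_inv] at this

theorem isInversion_simple_iff (w : SignedPerm n) {i : Fin n} (hi : (i : ℕ) ≠ 0) :
    IsInversion w (simple i) ↔ window w i < window w ⟨(i : ℕ) - 1, by omega⟩ := by
  have h1 : (simple i).1 (pos ⟨(i : ℕ) - 1, by omega⟩) = pos i := by
    rw [simple_eq_ofPerm i hi, ofPerm_pos, Equiv.swap_apply_left]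
  have h2 := (isPairSwap_simple i).isInversion_iff w (x := pos ⟨(i : ℕ) - 1, by omega⟩)
    (by rw [h1, pos_val, pos_val]; simp only; omega)
  rw [h2, h1]
  rfl

theorem lt_length_mul_simple_iff (w : SignedPerm n) {i : Fin n} (hi : (i : ℕ) ≠ 0) :
    wordLength (generators n) w < wordLength (generators n) (w * simple i) ↔
      window w ⟨(i : ℕ) - 1, by omega⟩ < window w i := by
  rw [(isInversionCocycle n).lt_length_iff (mem_reflections_of_mem ⟨i, rfl⟩),
    isInversion_simple_iff w hi, not_lt]
  refine ⟨fun h => lt_of_le_of_ne h fun he => ?_, le_of_lt⟩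
  have := congrArg Subtype.val (val_injective w he)
  rw [pos_val, pos_val] at this
  simp only at this
  omega

theorem window_strictMono_of_mem_quotientJ {a : SignedPerm n} (ha : a ∈ quotientJ n) :
    StrictMono (window a) := by
  rcases n with _ | n
  · exact Subsingleton.strictMono _
  · rw [Fin.strictMono_iff_lt_succ]
    intro i
    exact (lt_length_mul_simple_iff a (i := i.succ) (by simp)).mp (ha _ ⟨i.succ, by simp, rfl⟩)

end SignedPerm
/-! ### Equidistribution of the major index and the length on permutations -/

namespace SignedPerm

open PlusMinus LaurentPolynomial

variable {n : ℕ}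

/-- `τ` fixes every index `≥ m`. -/
def FixesFrom (m : ℕ) (τ : Equiv.Perm (Fin n)) : Prop := ∀ j : Fin n, m ≤ (j : ℕ) → τ j = j

theorem FixesFrom.mul {m : ℕ} {σ τ : Equiv.Perm (Fin n)} (hσ : FixesFrom m σ)
    (hτ : FixesFrom m τ) : FixesFrom m (σ * τ) := fun j hj => by
  rw [Equiv.Perm.mul_apply, hτ j hj, hσ j hj]

theorem FixesFrom.inv {m : ℕ} {τ : Equiv.Perm (Fin n)} (hτ : FixesFrom m τ) :
    FixesFrom m τ⁻¹ := fun j hj => by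
  rw [Equiv.Perm.inv_eq_iff_eq, hτ j hj]

theorem FixesFrom.apply_lt {m : ℕ} {τ : Equiv.Perm (Fin n)} (hτ : FixesFrom m τ) {j : Fin n}
    (hj : (j : ℕ) < m) : (τ j : ℕ) < m := by
  by_contra h
  have := τ.injective (hτ (τ j) (not_lt.mp h))
  rw [this] at h
  exact h hj

/-- The cycle raises the values below `m` by one and turns the value `m`, at index `p`, into `0`.
Only the descents next to `p` change: the one of weight `p + 1` at `p` is replaced by one of weight
`p` just before it. -/
theorem permMajorIndex_cycleRange_mul {m : Fin n} {τ : Equiv.Perm (Fin n)}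
    (hτ : FixesFrom (m + 1) τ) (hm : τ m < m) :
    permMajorIndex τ = permMajorIndex (m.cycleRange * τ) + 1 := by
  set p := τ⁻¹ m with hp
  have hτp : τ p = m := by rw [hp]; exact τ.apply_symm_apply m
  have hpm : (p : ℕ) < m := by
    have h1 := hτ.inv.apply_lt (j := m) (Nat.lt_succ_self _)
    rw [← hp] at h1
    have h2 : (p : ℕ) ≠ m := fun h => by
      rw [Fin.ext h] at hτp
      exact hm.ne hτp
    omega
  have hc : ∀ j : Fin n, ((m.cycleRange (τ j) : Fin n) : ℕ) =
      if (τ j : ℕ) < m then (τ j : ℕ) + 1 else if j = p then 0 else (τ j : ℕ) := by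
    intro j
    have hj : j = p ↔ (τ j : ℕ) = m := by
      rw [← Fin.ext_iff, ← hτp, τ.injective.eq_iff]
    simp only [hj]
    rcases lt_trichotomy (τ j) m with h | h | h
    · rw [Fin.coe_cycleRange_of_lt h, if_pos (Fin.lt_def.mp h)]
    · rw [Fin.coe_cycleRange_of_le h.le, if_pos h, if_neg (by rw [h]; omega),
        if_pos (by rw [h])]
    · rw [Fin.cycleRange_of_gt h, if_neg (by rw [Fin.lt_def] at h; omega),
        if_neg (by rw [Fin.lt_def] at h; omega)]
  have hle : ∀ j : Fin n, ((j : ℕ) ≤ m → (τ j : ℕ) ≤ m) ∧ ((m : ℕ) < j → (τ j : ℕ) = j) ∧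
      ((τ j : ℕ) = m ↔ j = p) := by
    intro j
    refine ⟨fun h => ?_, fun h => by rw [hτ j h], ?_⟩
    · have := hτ.apply_lt (j := j) (by omega)
      omega
    · rw [← Fin.ext_iff, ← hτp, τ.injective.eq_iff]
  have key : ∀ i : Fin n,
      (if ∃ h : (i : ℕ) + 1 < n, ((τ ⟨(i : ℕ) + 1, h⟩ : ℕ) : ℤ) + 1 < ((τ i : ℕ) : ℤ) + 1
        then (i : ℤ) + 1 else 0) =
      (if ∃ h : (i : ℕ) + 1 < n, ((m.cycleRange (τ ⟨(i : ℕ) + 1, h⟩) : ℕ) : ℤ) + 1 <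
        ((m.cycleRange (τ i) : ℕ) : ℤ) + 1 then (i : ℤ) + 1 else 0) +
      (if i = p then (i : ℤ) + 1 else 0) - (if (i : ℕ) + 1 = p then (p : ℤ) else 0) := by
    intro i
    by_cases h : (i : ℕ) + 1 < n
    · simp only [h, exists_true_left]
      have ha := hle i
      have hb := hle ⟨(i : ℕ) + 1, h⟩
      have hca := hc i
      have hcb := hc ⟨(i : ℕ) + 1, h⟩
      have hne : (τ i : ℕ) ≠ τ ⟨(i : ℕ) + 1, h⟩ := fun h0 => by
        have := congrArg Fin.val (τ.injective (Fin.ext h0))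
        simp only at this
        omega
      simp only [Fin.ext_iff] at ha hb hca hcb ⊢
      generalize (τ i : ℕ) = a at *
      generalize (τ ⟨(i : ℕ) + 1, h⟩ : ℕ) = b at *
      rw [hca, hcb]
      split_ifs <;> omega
    · have h1 : i ≠ p := fun h0 => by rw [h0] at h; omega
      have h2 : (i : ℕ) + 1 ≠ p := fun h0 => by omega
      simp [h, h1, h2]
  -- For `p = 0` there is no earlier position, and the empty contribution is again `p`.
  have hsum : ∑ i : Fin n, (if (i : ℕ) + 1 = p then (p : ℤ) else 0) = p := by
    by_cases h0 : (p : ℕ) = 0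
    · simp [h0]
    · rw [Finset.sum_eq_single ⟨(p : ℕ) - 1, by omega⟩]
      · rw [if_pos (by simp only; omega)]
      · intro j _ hj
        rw [if_neg]
        intro h1
        exact hj (Fin.ext (by simp only; omega))
      · simp
  simp only [permMajorIndex, majorIndex, Equiv.Perm.mul_apply, key, Finset.sum_add_distrib,
    Finset.sum_sub_distrib, hsum, Finset.sum_ite_eq', Finset.mem_univ, if_true]
  rw [add_sub_assoc, add_sub_cancel_left]
  congr!

/-- Since `k - 1` is the value at `m` and later indices are fixed, `k` stands to the left of `k -
1`; exchanging these values removes an inversion. -/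
theorem length_ofPerm_swap_mul {m : Fin n} {τ : Equiv.Perm (Fin n)} (hτ : FixesFrom (m + 1) τ)
    {k : Fin n} (hk : (k : ℕ) ≠ 0) (hkm : k ≤ m) (hm : (τ m : ℕ) = (k : ℕ) - 1) :
    length (ofPerm τ) = length (ofPerm (Equiv.swap ⟨(k : ℕ) - 1, by omega⟩ k * τ)) + 1 := by
  have h := isInversionCocycle n
  set j : Fin n := ⟨(k : ℕ) - 1, by omega⟩ with hj
  have hτm : τ m = j := Fin.ext hm
  have hlt : τ⁻¹ k < τ⁻¹ j := by
    have h1 : τ⁻¹ j = m := by rw [Equiv.Perm.inv_eq_iff_eq, hτm]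
    have h2 := hτ.inv.apply_lt (j := k) (by rw [Fin.le_def] at hkm; omega)
    have h3 : τ⁻¹ k ≠ m := fun h0 => by
      rw [Equiv.Perm.inv_eq_iff_eq, hτm] at h0
      have := congrArg Fin.val h0
      simp only [hj] at this
      omega
    rw [h1]
    have : ((τ⁻¹ k : Fin n) : ℕ) ≠ m := fun h0 => h3 (Fin.ext h0)
    rw [Fin.lt_def]; omega
  have hs : simple k ∈ generators n := ⟨k, rfl⟩
  rw [map_mul, ← simple_eq_ofPerm k hk]
  refine h.length_of_mul_left_lt hs ((h.lt_or_gt_left (ofPerm τ) hs).resolve_left ?_)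
  rw [h.length_left_eq _ hs, ← h.length_inv (ofPerm τ), lt_length_mul_simple_iff _ hk, ← map_inv,
    window_ofPerm, window_ofPerm, not_lt]
  rw [Fin.lt_def] at hlt
  change (((τ⁻¹ k : Fin n) : ℕ) : ℤ) + 1 ≤ (((τ⁻¹ j : Fin n) : ℕ) : ℤ) + 1
  omega

theorem permMajorIndex_one : permMajorIndex (1 : Equiv.Perm (Fin n)) = 0 := by
  rw [permMajorIndex, majorIndex]
  refine Finset.sum_eq_zero fun i _ => if_neg ?_
  rintro ⟨h, h1⟩
  simp only [Equiv.Perm.coe_one, id_eq] at h1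
  omega

open Classical in
/-- The generating function of `F` over the `τ` that fix all indices `≥ m`. -/
noncomputable def fixSum (F : Equiv.Perm (Fin n) → ℤ) (m : ℕ) : LaurentPolynomial ℕ :=
  ∑ τ with FixesFrom m τ, T (F τ)

open Classical in
/-- The generating function of `F` over the `τ` with `τ m = k` that fix all indices `> m`. -/
noncomputable def fixSumAt (F : Equiv.Perm (Fin n) → ℤ) (m : Fin n) (k : ℕ) :
    LaurentPolynomial ℕ :=
  ∑ τ with FixesFrom (m + 1) τ ∧ (τ m : ℕ) = k, T (F τ)

theorem fixSumAt_self (F : Equiv.Perm (Fin n) → ℤ) (m : Fin n) :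
    fixSumAt F m m = fixSum F m := by
  unfold fixSumAt fixSum
  congr 1
  ext τ
  simp only [Finset.mem_filter, Finset.mem_univ, true_and, ← Fin.ext_iff]
  constructor
  · rintro ⟨h1, h2⟩ j hj
    rcases hj.eq_or_lt with h3 | h3
    · rw [← Fin.ext h3, h2]
    · exact h1 j h3
  · intro h
    exact ⟨fun j hj => h j (by omega), h m le_rfl⟩

theorem fixSum_succ (F : Equiv.Perm (Fin n) → ℤ) (m : Fin n) :
    fixSum F (m + 1) = ∑ k ∈ Finset.range (m + 1), fixSumAt F m k := by
  classical
  unfold fixSumAt fixSum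
  rw [← Finset.sum_fiberwise_of_maps_to (t := Finset.range (m + 1))
    (g := fun τ : Equiv.Perm (Fin n) => (τ m : ℕ))]
  · refine Finset.sum_congr rfl fun k _ => ?_
    rw [Finset.filter_filter]
  · intro τ hτ
    rw [Finset.mem_filter] at hτ
    exact Finset.mem_range.mpr (hτ.2.apply_lt (Nat.lt_succ_self _))

theorem fixSumAt_eq_mul (F : Equiv.Perm (Fin n) → ℤ) (m : Fin n) (k : ℕ)
    (c : Equiv.Perm (Fin n)) (hc : FixesFrom (m + 1) c)
    (hk : ∀ j : Fin n, (j : ℕ) = k ↔ (c j : ℕ) = k + 1)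
    (hF : ∀ τ, FixesFrom (m + 1) τ → (τ m : ℕ) = k → F τ = F (c * τ) + 1) :
    fixSumAt F m k = T 1 * fixSumAt F m (k + 1) := by
  classical
  unfold fixSumAt
  rw [Finset.mul_sum]
  refine Finset.sum_equiv (Equiv.mulLeft c) ?_ ?_
  · intro τ
    simp only [Finset.mem_filter, Finset.mem_univ, true_and, Equiv.coe_mulLeft,
      Equiv.Perm.mul_apply, hk]
    refine and_congr_left fun _ => ⟨hc.mul, fun h => ?_⟩
    have := hc.inv.mul h
    rwa [inv_mul_cancel_left] at this
  · intro τ hτ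
    rw [Finset.mem_filter] at hτ
    rw [Equiv.coe_mulLeft, hF τ hτ.2.1 hτ.2.2, add_comm, T_add]

theorem fixSumAt_permMajorIndex (m : Fin n) {k : ℕ} (hk : k < m) :
    fixSumAt permMajorIndex m k = T 1 * fixSumAt permMajorIndex m (k + 1) := by
  refine fixSumAt_eq_mul _ m k m.cycleRange ?_ ?_ ?_
  · intro j hj
    exact Fin.cycleRange_of_gt (Fin.lt_def.mpr hj)
  · intro j
    rcases lt_trichotomy j m with h | h | h
    · rw [Fin.coe_cycleRange_of_lt h]; omega
    · rw [Fin.coe_cycleRange_of_le h.le, if_pos h, h]; omega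
    · rw [Fin.cycleRange_of_gt h]
      rw [Fin.lt_def] at h
      omega
  · intro τ hτ hτk
    exact permMajorIndex_cycleRange_mul hτ (Fin.lt_def.mpr (by omega))

theorem fixSumAt_length (m : Fin n) {k : ℕ} (hk : k < m) :
    fixSumAt (fun τ : Equiv.Perm (Fin n) => (length (ofPerm τ) : ℤ)) m k =
      T 1 * fixSumAt (fun τ : Equiv.Perm (Fin n) => (length (ofPerm τ) : ℤ)) m (k + 1) := by
  have hkn : k + 1 < n := by omega
  refine fixSumAt_eq_mul _ m k (Equiv.swap ⟨k, by omega⟩ ⟨k + 1, hkn⟩) ?_ ?_ ?_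
  · intro j hj
    refine Equiv.swap_apply_of_ne_of_ne ?_ ?_ <;> rw [Ne, Fin.ext_iff] <;> simp only <;> omega
  · intro j
    rw [Equiv.swap_apply_def]
    simp only [Fin.ext_iff]
    split_ifs <;> simp [*]
  · intro τ hτ hτk
    have := length_ofPerm_swap_mul hτ (k := ⟨k + 1, hkn⟩) (by simp) (Fin.le_def.mpr hk)
      (by simpa using hτk)
    rw [this]
    push_cast
    rfl

/-- The recursion in `k` expresses every `fixSumAt F m k` through `fixSumAt F m m = fixSum F m`, so
`fixSum F (m + 1)` is determined by `fixSum F m`, and ultimately by `F 1`. -/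
theorem fixSum_congr {F F' : Equiv.Perm (Fin n) → ℤ} (h1 : F 1 = F' 1)
    (hF : ∀ (m : Fin n) (k : ℕ), k < m → fixSumAt F m k = T 1 * fixSumAt F m (k + 1))
    (hF' : ∀ (m : Fin n) (k : ℕ), k < m → fixSumAt F' m k = T 1 * fixSumAt F' m (k + 1))
    {m : ℕ} (hm : m ≤ n) : fixSum F m = fixSum F' m := by
  classical
  induction m with
  | zero =>
    unfold fixSum
    refine Finset.sum_congr rfl fun τ hτ => ?_
    rw [Finset.mem_filter] at hτ
    have : τ = 1 := Equiv.ext fun j => hτ.2 j (Nat.zero_le _)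
    rw [this, h1]
  | succ m ih =>
    have hm' : m < n := hm
    -- The recursion runs downwards from `k = m`, hence the induction on `d = m - k`.
    have key : ∀ d ≤ m, fixSumAt F ⟨m, hm'⟩ (m - d) = fixSumAt F' ⟨m, hm'⟩ (m - d) := by
      intro d hd
      induction d with
      | zero =>
        have e := fixSumAt_self F ⟨m, hm'⟩
        have e' := fixSumAt_self F' ⟨m, hm'⟩
        simp only at e e'
        rw [Nat.sub_zero, e, e', ih hm'.le]
      | succ d ihd =>
        have h2 : m - (d + 1) < ((⟨m, hm'⟩ : Fin n) : ℕ) := by simp only; omega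
        rw [hF _ _ h2, hF' _ _ h2, show m - (d + 1) + 1 = m - d by omega, ihd (by omega)]
    have e := fixSum_succ F ⟨m, hm'⟩
    have e' := fixSum_succ F' ⟨m, hm'⟩
    simp only at e e'
    rw [e, e']
    refine Finset.sum_congr rfl fun k hk => ?_
    rw [Finset.mem_range] at hk
    have := key (m - k) (by omega)
    rwa [show m - (m - k) = k by omega] at this

theorem fixSum_self (F : Equiv.Perm (Fin n) → ℤ) : fixSum F n = ∑ τ, T (F τ) := by
  classical
  unfold fixSum
  rw [Finset.filter_true_of_mem]
  intro τ _ j hj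
  exact absurd j.isLt (not_lt.mpr hj)

/-- MacMahon's theorem. -/
theorem sum_permMajorIndex (n : ℕ) :
    ∑ τ : Equiv.Perm (Fin n), (T (permMajorIndex τ) : LaurentPolynomial ℕ) =
      ∑ τ : Equiv.Perm (Fin n), T (length (ofPerm τ) : ℤ) := by
  rw [← fixSum_self, ← fixSum_self (fun τ => (length (ofPerm τ) : ℤ))]
  refine fixSum_congr ?_ (fun m k hk => fixSumAt_permMajorIndex m hk)
    (fun m k hk => fixSumAt_length m hk) le_rfl
  rw [permMajorIndex_one, map_one, length, wordLength_one]
  rfl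

end SignedPerm
/-! ### The parabolic decomposition -/

/-! ### Values taken by equidistributed functions. -/

theorem Equidistributed.exists_eq {X : Type*} [Finite X] {f g : X → ℤ}
    (h : Equidistributed f g) (x : X) : ∃ y, g y = f x := by
  classical
  have := Fintype.ofFinite X
  by_contra! hne
  unfold Equidistributed at h
  rw [finsum_eq_sum_of_fintype, finsum_eq_sum_of_fintype] at h
  have h1 := congrArg (fun p : LaurentPolynomial ℕ => p.coeff (f x)) h
  simp only [AddMonoidAlgebra.coeff_sum, Finsupp.coe_finsetSum, Finset.sum_apply,
    LaurentPolynomial.T_apply] at h1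
  rw [Finset.sum_eq_zero (s := Finset.univ) (f := fun y => if g y = f x then 1 else 0)
    fun y _ => if_neg (hne y)] at h1
  -- Coefficients in `ℕ` cannot cancel, so the term at `x` would have to vanish.
  have h2 := Finset.sum_eq_zero_iff.mp h1 x (Finset.mem_univ x)
  simp at h2

theorem Equidistributed.symm {X : Type*} [Finite X] {f g : X → ℤ} (h : Equidistributed f g) :
    Equidistributed g f := Eq.symm h

/-- Two equidistributed functions with maxima at the same point agree there. -/
theorem Equidistributed.eq_of_forall_le {X : Type*} [Finite X] {f g : X → ℤ}
    (h : Equidistributed f g) {m : X} (hf : ∀ x, f x ≤ f m) (hg : ∀ x, g x ≤ g m) :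
    f m = g m := by
  obtain ⟨y, hy⟩ := h.exists_eq m
  obtain ⟨z, hz⟩ := h.symm.exists_eq m
  exact le_antisymm (hy ▸ hg y) (hz ▸ hf z)

namespace SignedPerm

open LaurentPolynomial

variable {n : ℕ}

theorem le_def (u v : SignedPerm n) : u ≤ v ↔ BruhatLE (generators n) u v := Iff.rfl

theorem length_one : length (1 : SignedPerm n) = 0 := wordLength_one

/-- The factorization `w = w^J w_J`. -/
noncomputable def decomposition (n : ℕ) : SignedPerm n ≃ quotientJ n × parabolicJ n :=
  (Equiv.ofBijective (fun p : quotientJ n × parabolicJ n => (p.1 : SignedPerm n) * p.2) (by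
    have h := isInversionCocycle n
    constructor
    · rintro ⟨a, b⟩ ⟨a', b'⟩ he
      obtain ⟨h1, h2⟩ := h.factorization_unique (unsignedGenerators_subset n) a.2 a'.2 b.2 b'.2 he
      exact Prod.ext (Subtype.ext h1) (Subtype.ext h2)
    · intro w
      obtain ⟨a, ha, b, hb, he⟩ := h.exists_factorization (unsignedGenerators_subset n) w
      exact ⟨(⟨a, ha⟩, ⟨b, hb⟩), he.symm⟩)).symm

theorem decomposition_symm_apply (a : quotientJ n) (b : parabolicJ n) :
    (decomposition n).symm (a, b) = (a : SignedPerm n) * (b : SignedPerm n) := rfl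

theorem decomposition_mul (w : SignedPerm n) :
    w = ((decomposition n w).1 : SignedPerm n) * (decomposition n w).2 := by
  conv_lhs => rw [← (decomposition n).symm_apply_apply w]
  rfl

theorem length_mul (a : quotientJ n) (b : parabolicJ n) :
    length ((a : SignedPerm n) * (b : SignedPerm n)) = length (a : SignedPerm n) + length (b : SignedPerm n) :=
  (isInversionCocycle n).length_mul_of_mem_quotient (unsignedGenerators_subset n) a.2 b.2

theorem length_lt_of_lt {u v : SignedPerm n} (h : u < v) : length u < length v :=
  (BruhatLE.eq_or_length_lt h.le).resolve_left h.ne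

theorem eq_one_of_le_one {u : SignedPerm n} (h : u ≤ 1) : u = 1 :=
  le_antisymm h ((isInversionCocycle n).one_le u)

/-! ### Gradedness of `W`, `W^J` and `W_J`, and the good decomposition. -/

theorem isGradedPoset_length (n : ℕ) : IsGradedPoset (length (n := n)) := by
  have h := isInversionCocycle n
  refine ⟨⟨1, h.one_le⟩, h.exists_top, ?_, ?_⟩
  · intro x hx
    rw [eq_one_of_le_one (hx 1), length_one]
  · intro x y hxy
    have h1 := length_lt_of_lt hxy.lt
    by_contra hne
    obtain ⟨z, hxz, hzy, hz1, hz2⟩ := h.exists_between hxy.le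
      (by change length x + 2 ≤ length y; omega)
    exact hxy.2 (lt_of_le_of_ne hxz hz1.symm) (lt_of_le_of_ne hzy hz2)

theorem isGradedPoset_quotientJ (n : ℕ) :
    IsGradedPoset fun a : quotientJ n => length (a : SignedPerm n) := by
  have h := isInversionCocycle n
  have hJ := unsignedGenerators_subset n
  have h1 := h.one_mem_quotient hJ (one_notMem_generators n)
  obtain ⟨m, hm, hmax⟩ := h.exists_top_of_quotient hJ
  refine ⟨⟨⟨1, h1⟩, fun a => h.one_le a.1⟩, ⟨⟨m, hm⟩, fun a => hmax a.1 a.2⟩, ?_, ?_⟩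
  · intro x hx
    rw [eq_one_of_le_one (u := x.1) (hx ⟨1, h1⟩), length_one]
  · intro x y hxy
    have h1 : length x.1 < length y.1 := length_lt_of_lt hxy.lt
    by_contra hne
    obtain ⟨z, hz, hxz, hzy, hz1, hz2⟩ := h.exists_between_of_mem_quotient hJ x.2 y.2 hxy.le
      (by change length x.1 + 2 ≤ length y.1; omega)
    exact hxy.2 (c := ⟨z, hz⟩) (lt_of_le_of_ne hxz fun he => hz1 (congrArg Subtype.val he).symm)
      (lt_of_le_of_ne hzy fun he => hz2 (congrArg Subtype.val he))

theorem isGradedPoset_parabolicJ (n : ℕ) :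
    IsGradedPoset fun b : parabolicJ n => length (b : SignedPerm n) := by
  have h := isInversionCocycle n
  have hJ := unsignedGenerators_subset n
  obtain ⟨m, hm, hmax⟩ := h.exists_top_of_closure hJ
  refine ⟨⟨1, fun b => h.one_le b.1⟩, ⟨⟨m, hm⟩, fun b => hmax b.1 b.2⟩, ?_, ?_⟩
  · intro x hx
    rw [eq_one_of_le_one (u := x.1) (hx 1), length_one]
  · intro x y hxy
    have h1 : length x.1 < length y.1 := length_lt_of_lt hxy.lt
    by_contra hne
    obtain ⟨z, hxz, hzy, hz1, hz2⟩ := h.exists_between (u := x.1) (v := y.1) hxy.le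
      (by change length x.1 + 2 ≤ length y.1; omega)
    exact hxy.2 (c := ⟨z, h.mem_closure_of_le hJ hzy y.2⟩)
      (lt_of_le_of_ne hxz fun he => hz1 (congrArg Subtype.val he).symm)
      (lt_of_le_of_ne hzy fun he => hz2 (congrArg Subtype.val he))

theorem isGoodDecomposition (n : ℕ) : IsGoodDecomposition (decomposition n) length
    (fun a => length (a : SignedPerm n)) (fun b => length (b : SignedPerm n)) where
  le_iff_left b a a' := (isInversionCocycle n).mul_le_mul_iff_of_mem_quotient
    (unsignedGenerators_subset n) a.2 a'.2 b.2
  le_iff_right a b b' := (isInversionCocycle n).mul_le_mul_left_iff_of_mem_quotient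
    (unsignedGenerators_subset n) a.2 b.2 b'.2
  graded := isGradedPoset_length n
  graded_left := isGradedPoset_quotientJ n
  graded_right := isGradedPoset_parabolicJ n
  rank_eq x := by
    conv_lhs => rw [decomposition_mul x]
    exact length_mul _ _

/-! ### The major indices on the decomposition, and their values at the extrema. -/

theorem majorIndex_comp_strictMono {f : Fin n → ℤ} (hf : StrictMono f)
    (τ : Equiv.Perm (Fin n)) : majorIndex (fun i => f (τ i)) = permMajorIndex τ := by
  simp only [permMajorIndex, majorIndex]
  refine Finset.sum_congr rfl fun i _ => ?_
  simp only [hf.lt_iff_lt, Fin.lt_def, add_lt_add_iff_right, Nat.cast_lt]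

theorem negMajorIndex_mul (a : quotientJ n) (b : parabolicJ n) :
    negMajorIndex ((a : SignedPerm n) * (b : SignedPerm n)) =
      (length (a : SignedPerm n) : ℤ) + permMajorIndex ((permEquiv n).symm b) := by
  obtain ⟨τ, rfl⟩ := (permEquiv n).surjective b
  rw [MulEquiv.symm_apply_apply, coe_permEquiv, negMajorIndex, length_eq_of_mem_quotientJ a.2]
  have e : window ((a : SignedPerm n) * ofPerm τ) = fun i => window a.1 (τ i) :=
    funext fun i => window_mul_ofPerm _ _ _
  rw [e, majorIndex_comp_strictMono (window_strictMono_of_mem_quotientJ a.2),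
    Equiv.sum_comp τ fun i => if window a.1 i < 0 then window a.1 i else 0]
  ring

theorem equidistributed_permMajorIndex (n : ℕ) :
    Equidistributed (fun b : parabolicJ n => permMajorIndex ((permEquiv n).symm b))
      (fun b => (length (b : SignedPerm n) : ℤ)) := by
  unfold Equidistributed
  rw [← finsum_comp_equiv (permEquiv n).toEquiv, ← finsum_comp_equiv (permEquiv n).toEquiv,
    finsum_eq_sum_of_fintype, finsum_eq_sum_of_fintype]
  simpa [coe_permEquiv] using sum_permMajorIndex n

theorem permMajorIndex_le_of_descents {σ : Equiv.Perm (Fin n)}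
    (hσ : ∀ (i : Fin n) (h : (i : ℕ) + 1 < n), σ ⟨(i : ℕ) + 1, h⟩ < σ i)
    (τ : Equiv.Perm (Fin n)) : permMajorIndex τ ≤ permMajorIndex σ := by
  rw [permMajorIndex, permMajorIndex, majorIndex, majorIndex]
  refine Finset.sum_le_sum fun i _ => ?_
  by_cases h : (i : ℕ) + 1 < n
  · have := hσ i h
    rw [Fin.lt_def] at this
    rw [if_pos (c := ∃ h : (i : ℕ) + 1 < n, _ < ((σ i : ℕ) : ℤ) + 1) ⟨h, by omega⟩]
    split_ifs <;> omega
  · rw [if_neg fun ⟨h', _⟩ => h h', if_neg fun ⟨h', _⟩ => h h']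

theorem equivDistributed_permMajorIndex (n : ℕ) :
    EquivDistributed (fun b : parabolicJ n => permMajorIndex ((permEquiv n).symm b))
      (fun b => (length (b : SignedPerm n) : ℤ)) where
  equidistributed := equidistributed_permMajorIndex n
  eq_at_min b hb := by
    have : b = 1 := Subtype.ext (eq_one_of_le_one (u := b.1) (hb 1))
    rw [this, map_one, permMajorIndex_one, Subgroup.coe_one, length_one]
    rfl
  eq_at_max b hb := by
    refine (equidistributed_permMajorIndex n).eq_of_forall_le (fun c => ?_)
      fun c => Nat.cast_le.mpr (BruhatLE.length_le (hb c))
    apply permMajorIndex_le_of_descents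
    intro i hi
    obtain ⟨τ, rfl⟩ := (permEquiv n).surjective b
    rw [MulEquiv.symm_apply_apply]
    set k : Fin n := ⟨(i : ℕ) + 1, hi⟩
    have hk : (k : ℕ) ≠ 0 := Nat.succ_ne_zero _
    have hmem : simple k ∈ parabolicJ n := Subgroup.subset_closure ⟨k, hk, rfl⟩
    -- No `s_k` in `J` can lengthen the maximum of `W_J`, so every position of its window is a
    -- descent and `maj` is maximal there.
    have h1 := BruhatLE.length_le (hb (permEquiv n τ * ⟨simple k, hmem⟩))
    have h2 := mt (lt_length_mul_simple_iff (ofPerm τ) hk).mpr (not_lt.mpr h1)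
    rw [window_ofPerm, window_ofPerm] at h2
    have h3 : τ k ≠ τ i := fun h0 => by
      have := congrArg Fin.val (τ.injective h0)
      simp only [k] at this
      omega
    have h4 : (⟨(k : ℕ) - 1, by omega⟩ : Fin n) = i := Fin.ext (Nat.add_sub_cancel _ _)
    rw [h4] at h2
    have h5 : (τ k : ℕ) ≠ τ i := fun h0 => h3 (Fin.ext h0)
    rw [Fin.lt_def]
    omega

theorem equidistributed_negMajorIndex (n : ℕ) :
    Equidistributed (negMajorIndex (n := n)) (fun w => (length w : ℤ)) := by
  classical
  have := Fintype.ofFinite (quotientJ n)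
  have := Fintype.ofFinite (parabolicJ n)
  have hb := equidistributed_permMajorIndex n
  unfold Equidistributed at hb ⊢
  rw [finsum_eq_sum_of_fintype, finsum_eq_sum_of_fintype] at hb
  rw [← finsum_comp_equiv (decomposition n).symm, ← finsum_comp_equiv (decomposition n).symm,
    finsum_eq_sum_of_fintype, finsum_eq_sum_of_fintype, Fintype.sum_prod_type,
    Fintype.sum_prod_type]
  refine Finset.sum_congr rfl fun a _ => ?_
  simp only [decomposition_symm_apply, negMajorIndex_mul, length_mul, Nat.cast_add, T_add,
    ← Finset.mul_sum, hb]

theorem negMajorIndex_eq (w : SignedPerm n) : negMajorIndex w =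
    (length ((decomposition n w).1 : SignedPerm n) : ℤ) +
      permMajorIndex ((permEquiv n).symm (decomposition n w).2) := by
  conv_lhs => rw [decomposition_mul w]
  exact negMajorIndex_mul _ _

theorem equivDistributed_negMajorIndex (n : ℕ) :
    EquivDistributed (negMajorIndex (n := n)) (fun w => (length w : ℤ)) where
  equidistributed := equidistributed_negMajorIndex n
  eq_at_min w hw := by
    have hd := isGoodDecomposition n
    rw [negMajorIndex_eq, (equivDistributed_permMajorIndex n).eq_at_min, hd.rank_eq w,
      Nat.cast_add]
    intro b
    -- Elements with the same `W^J` component as `w` are compared through their `W_J` components, so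
    -- the minimality of `w` passes to its `W_J` component.
    rw [← hd.le_iff_right (decomposition n w).1]
    exact (((decomposition n).symm_apply_apply w).symm ▸ hw) _
  eq_at_max w hw := by
    have hd := isGoodDecomposition n
    rw [negMajorIndex_eq, (equivDistributed_permMajorIndex n).eq_at_max, hd.rank_eq w,
      Nat.cast_add]
    intro b
    rw [← hd.le_iff_right (decomposition n w).1]
    exact (((decomposition n).symm_apply_apply w).symm ▸ hw) _

end SignedPerm

theorem mainTheorem7 (n : ℕ) (hn : 2 ≤ n) :
    ∃ (e : SignedPerm n ≃ SignedPerm.quotientJ n × SignedPerm.parabolicJ n)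
      (φ : Equiv.Perm (Fin n) ≃* SignedPerm.parabolicJ n),
      -- `e` is the parabolic decomposition `w = w^J w_J`
      (∀ w : SignedPerm n, w = ((e w).1 : SignedPerm n) * ((e w).2 : SignedPerm n)) ∧
      -- `φ` identifies `S_n` with `W_J`, an element of either being read as a sequence
      (∀ (τ : Equiv.Perm (Fin n)) (i : Fin n),
        SignedPerm.window (φ τ : SignedPerm n) i = ((τ i : ℕ) : ℤ) + 1) ∧
      -- `nmaj` is induced by `maj`
      IsInducedBy e SignedPerm.length (fun a => SignedPerm.length (a : SignedPerm n))
        (fun b => SignedPerm.length (b : SignedPerm n)) negMajorIndex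
        (fun b => permMajorIndex (φ.symm b)) ∧
      -- that is, `nmaj = ℓ_B ∘ P^J + maj ∘ (·)_J`
      (∀ w : SignedPerm n, negMajorIndex w =
        (SignedPerm.length ((e w).1 : SignedPerm n) : ℤ) + permMajorIndex (φ.symm (e w).2)) := by
  refine ⟨SignedPerm.decomposition n, SignedPerm.permEquiv n, SignedPerm.decomposition_mul,
    SignedPerm.window_ofPerm, ⟨SignedPerm.isGoodDecomposition n,
      SignedPerm.equivDistributed_negMajorIndex n, SignedPerm.equivDistributed_permMajorIndex n,
      fun w => ?_⟩, SignedPerm.negMajorIndex_eq⟩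
  rw [SignedPerm.negMajorIndex_eq, add_sub_cancel_left]
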